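/- Let $n,m\ge 0$, let $f:\mathbb{R}^n\to\mathbb{R}$ be $C^2$ and strongly convex (that is, $f-\frac{\alpha}{2}\|\cdot\|^2$ is convex for some modulus $\alpha>0$), and let $g_1,\dots,g_m:\mathbb{R}^n\to\mathbb{R}$ be $C^2$, convex and Lipschitz continuous, such that $g=(g_1,\dots,g_m)$ has a bounded Jacobian, i.e. $\sup_x\|\nabla g(x)\|_F<\infty$. Let $x^*$ be the solution (assumed to exist; it is unique) of $$\min f(x)\quad\text{subject to}\quad g_k(x)\le 0,\ k=1,\dots,m,\quad x\in\mathbb{R}^n .$$ For $\lambda\in\mathbb{R}^m_+$ let $q(\lambda)=\min_{x\in\mathbb{R}^n}\{f(x)+\sum_k\lambda_kg_k(x)\}$ be the Lagrangian dual function. A Lagrange multiplier is a vector $\lambda^*\in\mathbb{R}^m_+$ with $q(\lambda^*)=f(x^*)$. Consider the following assumptions. - Assumption 1: $f$ is strongly convex with a modulus $\alpha>0$ and all the $g_k$ are Lipschitz continuous with a common modulus $\beta>0$. - Assumption 2 (strong duality): a Lagrange multiplier exists. - Assumption 3 (smooth dual): for some $\gamma>0$, $q$ is smooth on $\mathbb{R}^m_+$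 with modulus $\gamma$, i.e. it is differentiable on $\mathbb{R}^m_+$ (relative to $\mathbb{R}^m_+$) and its gradient is Lipschitz continuous there with modulus $\gamma$. - Assumption 4 (locally quadratic dual): for a Lagrange multiplier $\lambda^*$ there are $D_q,L_q>0$ with $q(\lambda^*)\ge q(\lambda)+L_q\|\lambda-\lambda^*\|^2$ for all $\lambda\in\mathbb{R}^m_+$ with $\|\lambda-\lambda^*\|\le D_q$. - Assumption 5 (locally strongly concave dual): for a Lagrange multiplier $\lambda^*$ there are $D_c,L_c>0$ such that $q$ is strongly concave with modulus $L_c$ on $\{\lambda\in\mathbb{R}^m_+:\|\lambda-\lambda^*\|\le D_c\}$. The drift-plus-penalty algorithm with shifted running averages, with parameter $V>0$ and initial queues $Q(0)\in\mathbb{R}^m_+$, computes for $t=0,1,2,\dots$ $$x(t)=\operatorname*{argmin}_{x\in\mathbb{R}^n}\Big[Vf(x)+\sum_kQ_k(t)g_k(x)\Big],\qquad Q_k(t+1)=\max\{Q_k(t)+g_k(x(t)),0\},$$ $$\overline{x}(t+1)=\frac{1}{(t+1)/2}\sum_{\tau=(t+1)/2}^{t}x(\tau)\ \text{ if } t+1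 \text{ is even},\qquad \overline{x}(t+1)=\overline{x}(t)\ \text{ if } t+1\text{ is odd}.$$ Its error decays like $O(r(t))$ if there are constants $C\ge 0$ and $T$ with $f(\overline{x}(t))\le f(x^*)+Cr(t)$ and $g_k(\overline{x}(t))\le Cr(t)$ for all $k$ and all $t\ge T$. Its convergence time is $O(h(\epsilon))$ if there is a constant $C>0$ such that, for all sufficiently small $\epsilon>0$ and all $t\ge Ch(\epsilon)$, the point $\overline{x}(t)$ is $\epsilon$-optimal, i.e. $f(\overline{x}(t))\le f(x^*)+\epsilon$ and $g_k(\overline{x}(t))\le\epsilon$ for all $k$. The constants $C$ and $T$ may depend on the problem, on $V$ and on $Q(0)$. 1. Let $\mathcal{K}=\{k:g_k(x^*)=0\}$. If the Jacobian of the active constraints satisfies $\operatorname{rank}\nabla g_{\mathcal{K}}(x^*)=|\mathcal{K}|$, then $q$ is well defined (the minimum is attained for every $\lambda\in\mathbb{R}^m_+$) and Assumptions 1, 2, 3 and 4 hold (the last one at every Lagrange multiplier). Moreover, for all moduli $\alpha,\beta,\gamma$ as in Assumptions 1 and 3, all $V>0$ with $V\ge\max\{m\beta^2/\alpha,\gamma\}$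 and all $Q(0)\in\mathbb{R}^m_+$, the algorithm can be run (the minimizers exist), its error decays like $O(1/t^{3/2})$, and its convergence time is $O(1/\epsilon^{2/3})$. 2. If the full Jacobian satisfies $\operatorname{rank}\nabla g(x^*)=m$, then $q$ is well defined and Assumptions 1, 2, 3 and 5 hold (the last one at every Lagrange multiplier). Moreover, for all moduli $\alpha,\beta,\gamma$ as in Assumptions 1 and 3, all $V>0$ with $V\ge\max\{m\beta^2/\alpha,\gamma\}$ and all $Q(0)\in\mathbb{R}^m_+$, the algorithm can be run; for every $\lambda^*,D_c,L_c$ as in Assumption 5 its error decays like $O\big(\frac1t(1-\frac{L_c}{V})^{t/4}\big)$; and its convergence time is $O(\log(1/\epsilon))$. -/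

import Mathlib

open Filter Topology

namespace DriftPlusPenalty

/-- The feasible set `{x ∈ ℝⁿ : g_k(x) ≤ 0 for all k}`. -/
def feasible {n m : ℕ} (g : Fin m → EuclideanSpace ℝ (Fin n) → ℝ) :
    Set (EuclideanSpace ℝ (Fin n)) :=
  {x | ∀ k, g k x ≤ 0}

/-- `xs` is an optimal solution of `min f(x)` subject to `g(x) ≤ 0`. -/
def IsSolution {n m : ℕ} (f : EuclideanSpace ℝ (Fin n) → ℝ)
    (g : Fin m → EuclideanSpace ℝ (Fin n) → ℝ) (xs : EuclideanSpace ℝ (Fin n)) : Prop :=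
  xs ∈ feasible g ∧ IsMinOn f (feasible g) xs

/-- A point is `ε`-optimal, relative to the optimal solution `xs`. -/
def IsEpsOptimal {n m : ℕ} (f : EuclideanSpace ℝ (Fin n) → ℝ)
    (g : Fin m → EuclideanSpace ℝ (Fin n) → ℝ) (xs : EuclideanSpace ℝ (Fin n))
    (ε : ℝ) (y : EuclideanSpace ℝ (Fin n)) : Prop :=
  f y ≤ f xs + ε ∧ ∀ k, g k y ≤ ε

/-- The Jacobian of `g` at `x`: row `k` is the gradient of `g_k`. -/
noncomputable def jacobian {n m : ℕ} (g : Fin m → EuclideanSpace ℝ (Fin n) → ℝ)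
    (x : EuclideanSpace ℝ (Fin n)) : Matrix (Fin m) (Fin n) ℝ :=
  Matrix.of fun k i => fderiv ℝ (g k) x (EuclideanSpace.single i 1)

/-- The rows of the Jacobian at `x` that belong to the constraints active at `x`. -/
noncomputable def activeJacobian {n m : ℕ} (g : Fin m → EuclideanSpace ℝ (Fin n) → ℝ)
    (x : EuclideanSpace ℝ (Fin n)) : Matrix {k : Fin m // g k x = 0} (Fin n) ℝ :=
  (jacobian g x).submatrix Subtype.val id

/-- The Frobenius norm of the Jacobian is bounded on `ℝⁿ`. -/
def HasBoundedJacobian {n m : ℕ} (g : Fin m → EuclideanSpace ℝ (Fin n) → ℝ) : Prop :=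
  ∃ c : ℝ, ∀ x, √(∑ k, ∑ i, (jacobian g x k i) ^ 2) ≤ c

/-- The nonnegative orthant `ℝ^m_+`. -/
def orthant (m : ℕ) : Set (EuclideanSpace ℝ (Fin m)) := {l | ∀ k, 0 ≤ l k}

/-- The Lagrangian `f(x) + ∑ₖ λₖ gₖ(x)`. -/
noncomputable def lagrangian {n m : ℕ} (f : EuclideanSpace ℝ (Fin n) → ℝ)
    (g : Fin m → EuclideanSpace ℝ (Fin n) → ℝ) (l : EuclideanSpace ℝ (Fin m))
    (x : EuclideanSpace ℝ (Fin n)) : ℝ :=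
  f x + ∑ k, l k * g k x

/-- The Lagrangian dual function; it is only used on `orthant m`. -/
noncomputable def dual {n m : ℕ} (f : EuclideanSpace ℝ (Fin n) → ℝ)
    (g : Fin m → EuclideanSpace ℝ (Fin n) → ℝ) (l : EuclideanSpace ℝ (Fin m)) : ℝ :=
  ⨅ x, lagrangian f g l x

/-- The infimum defining the dual function is an attained minimum throughout `ℝ^m_+`. -/
def DualWellDefined {n m : ℕ} (f : EuclideanSpace ℝ (Fin n) → ℝ)
    (g : Fin m → EuclideanSpace ℝ (Fin n) → ℝ) : Prop :=
  ∀ l ∈ orthant m, IsLeast (Set.range (lagrangian f g l)) (dual f g l)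

/-- `f` is strongly convex with modulus `α`, each `g_k` is Lipschitz with modulus `β`. -/
def StronglyConvexProgram {n m : ℕ} (f : EuclideanSpace ℝ (Fin n) → ℝ)
    (g : Fin m → EuclideanSpace ℝ (Fin n) → ℝ) (α β : ℝ) : Prop :=
  0 < α ∧ StrongConvexOn Set.univ α f ∧
  0 < β ∧ ∀ k x y, |g k y - g k x| ≤ β * ‖y - x‖

/-- `ls ≥ 0` and `q(ls)` is the optimal value of the program. -/
def IsLagrangeMultiplier {n m : ℕ} (f : EuclideanSpace ℝ (Fin n) → ℝ)
    (g : Fin m → EuclideanSpace ℝ (Fin n) → ℝ) (ls : EuclideanSpace ℝ (Fin m)) : Prop :=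
  ls ∈ orthant m ∧
  IsLeast (Set.range (lagrangian f g ls)) (dual f g ls) ∧
  IsLeast (f '' feasible g) (dual f g ls)

/-- Strong duality: a Lagrange multiplier exists. -/
def StrongDuality {n m : ℕ} (f : EuclideanSpace ℝ (Fin n) → ℝ)
    (g : Fin m → EuclideanSpace ℝ (Fin n) → ℝ) : Prop :=
  ∃ ls, IsLagrangeMultiplier f g ls

/-- The dual function is smooth on `ℝ^m_+` with modulus `γ`: it has a gradient there (relative to
`ℝ^m_+`, hence one-sided on the boundary) which is Lipschitz with modulus `γ`. -/
def SmoothDual {n m : ℕ} (f : EuclideanSpace ℝ (Fin n) → ℝ)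
    (g : Fin m → EuclideanSpace ℝ (Fin n) → ℝ) (γ : ℝ) : Prop :=
  0 < γ ∧ ∃ G : EuclideanSpace ℝ (Fin m) → EuclideanSpace ℝ (Fin m),
    (∀ l ∈ orthant m, HasGradientWithinAt (dual f g) (G l) (orthant m) l) ∧
    ∀ l ∈ orthant m, ∀ l' ∈ orthant m, ‖G l' - G l‖ ≤ γ * ‖l' - l‖

/-- Quadratic decay of the dual function around `ls`, with radius `D` and constant `L`. -/
def IsLocallyQuadraticAt {n m : ℕ} (f : EuclideanSpace ℝ (Fin n) → ℝ)
    (g : Fin m → EuclideanSpace ℝ (Fin n) → ℝ) (ls : EuclideanSpace ℝ (Fin m))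
    (D L : ℝ) : Prop :=
  0 < D ∧ 0 < L ∧ ∀ l ∈ orthant m, ‖l - ls‖ ≤ D →
    dual f g l + L * ‖l - ls‖ ^ 2 ≤ dual f g ls

/-- The dual function is locally quadratic at the Lagrange multiplier(s). -/
def LocallyQuadraticDual {n m : ℕ} (f : EuclideanSpace ℝ (Fin n) → ℝ)
    (g : Fin m → EuclideanSpace ℝ (Fin n) → ℝ) : Prop :=
  ∀ ls, IsLagrangeMultiplier f g ls → ∃ D L, IsLocallyQuadraticAt f g ls D L

/-- Strong concavity, with modulus `L`, of the dual function on the part of `ℝ^m_+` within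
distance `D` of `ls`. -/
def IsLocallyStronglyConcaveAt {n m : ℕ} (f : EuclideanSpace ℝ (Fin n) → ℝ)
    (g : Fin m → EuclideanSpace ℝ (Fin n) → ℝ) (ls : EuclideanSpace ℝ (Fin m))
    (D L : ℝ) : Prop :=
  0 < D ∧ 0 < L ∧ StrongConcaveOn {l | l ∈ orthant m ∧ ‖l - ls‖ ≤ D} L (dual f g)

/-- The dual function is locally strongly concave at the Lagrange multiplier(s). -/
def LocallyStronglyConcaveDual {n m : ℕ} (f : EuclideanSpace ℝ (Fin n) → ℝ)
    (g : Fin m → EuclideanSpace ℝ (Fin n) → ℝ) : Prop :=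
  ∀ ls, IsLagrangeMultiplier f g ls → ∃ D L, IsLocallyStronglyConcaveAt f g ls D L

/-- The drift-plus-penalty algorithm with shifted running averages, with parameter `V` and initial
queues `Q0`: `x` are the primal iterates, `Q` the virtual queues, `xbar` the shifted averages. -/
structure IsShiftedRun {n m : ℕ} (f : EuclideanSpace ℝ (Fin n) → ℝ)
    (g : Fin m → EuclideanSpace ℝ (Fin n) → ℝ) (V : ℝ) (Q0 : EuclideanSpace ℝ (Fin m))
    (x : ℕ → EuclideanSpace ℝ (Fin n)) (Q : ℕ → EuclideanSpace ℝ (Fin m))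
    (xbar : ℕ → EuclideanSpace ℝ (Fin n)) : Prop where
  init : Q 0 = Q0
  argmin : ∀ t, IsMinOn (fun y => V * f y + ∑ k, Q t k * g k y) Set.univ (x t)
  queue : ∀ t k, Q (t + 1) k = max (Q t k + g k (x t)) 0
  avg_even : ∀ t, Even (t + 1) →
    xbar (t + 1) = (((t + 1 : ℕ) : ℝ) / 2)⁻¹ • ∑ τ ∈ Finset.Ico ((t + 1) / 2) (t + 1), x τ
  avg_odd : ∀ t, Odd (t + 1) → xbar (t + 1) = xbar t

/-- For the algorithm started with `V`, `Q0`, the objective error and the constraint violations of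
`xbar t` are `O(r t)`. -/
def ErrorDecaysLike {n m : ℕ} (f : EuclideanSpace ℝ (Fin n) → ℝ)
    (g : Fin m → EuclideanSpace ℝ (Fin n) → ℝ) (xs : EuclideanSpace ℝ (Fin n))
    (V : ℝ) (Q0 : EuclideanSpace ℝ (Fin m)) (r : ℕ → ℝ) : Prop :=
  ∃ C : ℝ, 0 ≤ C ∧ ∃ T : ℕ, ∀ x Q xbar, IsShiftedRun f g V Q0 x Q xbar →
    ∀ t, T ≤ t → f (xbar t) ≤ f xs + C * r t ∧ ∀ k, g k (xbar t) ≤ C * r t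

/-- For the algorithm started with `V`, `Q0`, the convergence time is `O(h ε)` as `ε → 0+`:
`xbar t` is `ε`-optimal for all `t ≥ C * h ε`. -/
def HasConvergenceTime {n m : ℕ} (f : EuclideanSpace ℝ (Fin n) → ℝ)
    (g : Fin m → EuclideanSpace ℝ (Fin n) → ℝ) (xs : EuclideanSpace ℝ (Fin n))
    (V : ℝ) (Q0 : EuclideanSpace ℝ (Fin m)) (h : ℝ → ℝ) : Prop :=
  ∃ C : ℝ, 0 < C ∧ ∀ᶠ ε in 𝓝[>] (0 : ℝ), ∀ x Q xbar, IsShiftedRun f g V Q0 x Q xbar →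
    ∀ t : ℕ, C * h ε ≤ (t : ℝ) → IsEpsOptimal f g xs ε (xbar t)

end DriftPlusPenalty

/-!
The scaled queues `λ t = Q t / V` perform projected gradient ascent with step size `1 / V` on the
dual function: `x t` minimizes the Lagrangian at `λ t`, so the vector `g (x t)` is a supergradient
there, and `V ≥ m β² / α` makes the step size admissible. Hence the distance to a multiplier `λ*`
never increases. Telescoping the drift-plus-penalty inequality over the averaging window bounds both
errors of the shifted average by a constant times `‖λ (t / 2) - λ*‖ / t`, and it remains to see how
fast this distance decays.

This is decided by the curvature of the dual function near `λ*`, which comes from the constraint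
gradients: their linear independence lets a perturbation of the multiplier be answered by a step
that lowers the Lagrangian quadratically. Independence of the active gradients gives quadratic decay
of the dual function away from `λ*`, hence a distance of order `1 / √t`; independence of all
gradients gives local strong concavity, hence a distance that decays geometrically.
-/

namespace DriftPlusPenalty

section StrongConvexity

variable {E : Type*} [NormedAddCommGroup E] [NormedSpace ℝ E] {s : Set E} {h : E → ℝ} {α : ℝ}
  {x y : E}

lemma add_le_of_forall_one_sub_mul {a b c : ℝ}
    (hle : ∀ r : ℝ, 0 < r → r < 1 → a + (1 - r) * b ≤ c) : a + b ≤ c := by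
  have hcont : Continuous fun r : ℝ => a + (1 - r) * b := by fun_prop
  have hlim : Tendsto (fun r : ℝ => a + (1 - r) * b) (𝓝[>] 0) (𝓝 (a + b)) := by
    simpa using (hcont.tendsto 0).mono_left nhdsWithin_le_nhds
  refine le_of_tendsto hlim ?_
  filter_upwards [Ioo_mem_nhdsGT (zero_lt_one' ℝ)] with r hr using hle r hr.1 hr.2

lemma add_sq_le_of_forall_add_le (hh : StrongConvexOn s α h) (hx : x ∈ s) (hy : y ∈ s)
    {φ : E →ₗ[ℝ] ℝ} (hφ : ∀ z ∈ s, h x + φ (z - x) ≤ h z) :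
    h x + φ (y - x) + α / 2 * ‖y - x‖ ^ 2 ≤ h y := by
  refine add_le_of_forall_one_sub_mul fun r hr₀ hr₁ => ?_
  have hseg := hh.2 hx hy (sub_nonneg.2 hr₁.le) hr₀.le (by ring)
  have hsub := hφ _ (hh.1 hx hy (sub_nonneg.2 hr₁.le) hr₀.le (by ring))
  rw [show (1 - r) • x + r • y - x = r • (y - x) by module, map_smul] at hsub
  rw [norm_sub_rev x y] at hseg
  simp only [smul_eq_mul] at hseg hsub
  refine le_of_mul_le_mul_left ?_ hr₀
  linarith

lemma add_sq_le_of_isMinOn (hh : StrongConvexOn s α h) (hx : x ∈ s) (hy : y ∈ s)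
    (hmin : IsMinOn h s x) : h x + α / 2 * ‖y - x‖ ^ 2 ≤ h y := by
  simpa using add_sq_le_of_forall_add_le (φ := 0) hh hx hy fun z hz => by simpa using hmin hz

lemma le_add_sub_sq_of_forall_le_add (hh : StrongConcaveOn s α h) (hx : x ∈ s) (hy : y ∈ s)
    {φ : E →ₗ[ℝ] ℝ} (hφ : ∀ z ∈ s, h z ≤ h x + φ (z - x)) :
    h y ≤ h x + φ (y - x) - α / 2 * ‖y - x‖ ^ 2 := by
  have hneg := add_sq_le_of_forall_add_le (φ := -φ) hh.neg hx hy fun z hz => by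
    have := hφ z hz
    simp only [Pi.neg_apply, LinearMap.neg_apply]
    linarith
  simp only [Pi.neg_apply, LinearMap.neg_apply] at hneg
  linarith

lemma strongConcaveOn_of_forall_exists (hs : Convex ℝ s)
    (hφ : ∀ x ∈ s, ∃ φ : E →ₗ[ℝ] ℝ, ∀ z ∈ s, h z ≤ h x + φ (z - x) - α / 2 * ‖z - x‖ ^ 2) :
    StrongConcaveOn s α h := by
  refine ⟨hs, fun x hx y hy a b ha hb hab => ?_⟩
  obtain ⟨φ, hφ⟩ := hφ _ (hs hx hy ha hb hab)
  obtain rfl : a = 1 - b := by linarith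
  have hx' := mul_le_mul_of_nonneg_left (hφ x hx) ha
  have hy' := mul_le_mul_of_nonneg_left (hφ y hy) hb
  rw [show x - ((1 - b) • x + b • y) = b • (x - y) by module, map_smul, norm_smul,
    Real.norm_of_nonneg hb, smul_eq_mul] at hx'
  rw [show y - ((1 - b) • x + b • y) = (-(1 - b)) • (x - y) by module, map_smul, norm_smul,
    norm_neg, Real.norm_of_nonneg ha, smul_eq_mul] at hy'
  simp only [smul_eq_mul]
  linarith

lemma add_norm_mul_le_of_one_le_norm (hh : StrongConvexOn Set.univ α h) {b : ℝ}
    (hb : ∀ z ∈ Metric.closedBall (0 : E) 1, b ≤ h z) (hy : 1 ≤ ‖y‖) :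
    h 0 + ‖y‖ * (α / 2 * (‖y‖ - 1) - (h 0 - b)) ≤ h y := by
  have hnorm : 0 < ‖y‖ := zero_lt_one.trans_le hy
  have hseg := hh.2 (Set.mem_univ 0) (Set.mem_univ y) (sub_nonneg.2 (inv_le_one_of_one_le₀ hy))
    (inv_nonneg.2 hnorm.le) (by ring)
  have hball := hb ((1 - ‖y‖⁻¹) • (0 : E) + ‖y‖⁻¹ • y) (by simp [norm_smul, hnorm.ne'])
  simp only [smul_eq_mul, zero_sub, norm_neg] at hseg
  have hmul := mul_le_mul_of_nonneg_left (hball.trans hseg) hnorm.le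
  field_simp at hmul
  linarith

lemma exists_isMinOn_of_strongConvexOn [FiniteDimensional ℝ E] (hα : 0 < α)
    (hh : StrongConvexOn Set.univ α h) : ∃ x, IsMinOn h Set.univ x := by
  have := FiniteDimensional.proper ℝ E
  have hcont : Continuous h := continuousOn_univ.1 <|
    (hh.convexOn fun _ => by positivity).continuousOn isOpen_univ
  obtain ⟨z, -, hz⟩ := (isCompact_closedBall (0 : E) 1).exists_isMinOn
    ⟨0, by simp⟩ hcont.continuousOn
  have hcoercive : ∀ᶠ y in cocompact E, h 0 ≤ h y := by
    rw [← Metric.cobounded_eq_cocompact]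
    filter_upwards [tendsto_norm_cobounded_atTop.eventually_ge_atTop (1 + 2 * (h 0 - h z) / α)]
      with y hy
    have hgap : 0 ≤ h 0 - h z := sub_nonneg.2 (hz (by simp))
    have hfrac : 0 ≤ 2 * (h 0 - h z) / α := by positivity
    have hgrowth := add_norm_mul_le_of_one_le_norm hh (fun _ h => hz h) (by linarith : 1 ≤ ‖y‖)
    have hfactor : 0 ≤ α / 2 * (‖y‖ - 1) - (h 0 - h z) := by
      have : 2 * (h 0 - h z) / α ≤ ‖y‖ - 1 := by linarith
      rw [div_le_iff₀ hα] at this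
      linarith
    nlinarith [norm_nonneg y]
  obtain ⟨x, hx⟩ := hcont.exists_forall_le' 0 hcoercive
  exact ⟨x, fun y _ => hx y⟩

lemma isMinOn_of_convexOn_of_hasFDerivAt_zero (hh : ConvexOn ℝ Set.univ h)
    (hd : HasFDerivAt h (0 : E →L[ℝ] ℝ) x) : IsMinOn h Set.univ x := by
  intro y _
  have hline : HasDerivAt (h ∘ AffineMap.lineMap (k := ℝ) x y) 0 0 := by
    have hd' : HasFDerivAt h (0 : E →L[ℝ] ℝ) (AffineMap.lineMap x y (0 : ℝ)) := by simpa using hd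
    simpa using hd'.comp_hasDerivAt (0 : ℝ) AffineMap.hasDerivAt_lineMap
  have hslope := (hh.comp_affineMap (AffineMap.lineMap (k := ℝ) x y)).le_slope_of_hasDerivAt
    (Set.mem_univ 0) (Set.mem_univ 1) one_pos hline
  simpa [slope_def_field] using hslope

end StrongConvexity

section Lagrangian

variable {n m : ℕ} {f : EuclideanSpace ℝ (Fin n) → ℝ}
  {g : Fin m → EuclideanSpace ℝ (Fin n) → ℝ} {α β V : ℝ} {l l' : EuclideanSpace ℝ (Fin m)}
  {x x' : EuclideanSpace ℝ (Fin n)}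

/-- The vector `g(x) = (g₁(x), …, gₘ(x))` of constraint values, as a point of the Euclidean space
in which the multipliers live. -/
noncomputable def constraintVec (g : Fin m → EuclideanSpace ℝ (Fin n) → ℝ)
    (x : EuclideanSpace ℝ (Fin n)) : EuclideanSpace ℝ (Fin m) :=
  WithLp.toLp 2 fun k => g k x

/-- The minimizer `x(λ)` of the Lagrangian; an arbitrary point if there is no minimizer. -/
noncomputable def argminLagrangian (f : EuclideanSpace ℝ (Fin n) → ℝ)
    (g : Fin m → EuclideanSpace ℝ (Fin n) → ℝ) (l : EuclideanSpace ℝ (Fin m)) :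
    EuclideanSpace ℝ (Fin n) :=
  Classical.epsilon fun x => IsMinOn (lagrangian f g l) Set.univ x

@[simp] lemma constraintVec_apply (x : EuclideanSpace ℝ (Fin n)) (k : Fin m) :
    constraintVec g x k = g k x := rfl

lemma inner_eq_sum (u v : EuclideanSpace ℝ (Fin m)) : inner ℝ u v = ∑ k, u k * v k := by
  simp [PiLp.inner_apply, mul_comm]

lemma lagrangian_eq_add_inner (l : EuclideanSpace ℝ (Fin m)) (x : EuclideanSpace ℝ (Fin n)) :
    lagrangian f g l x = f x + inner ℝ l (constraintVec g x) := by
  simp [lagrangian, inner_eq_sum]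

lemma lagrangian_eq_lagrangian_add_inner (l l' : EuclideanSpace ℝ (Fin m))
    (x : EuclideanSpace ℝ (Fin n)) :
    lagrangian f g l' x = lagrangian f g l x + inner ℝ (l' - l) (constraintVec g x) := by
  rw [lagrangian_eq_add_inner, lagrangian_eq_add_inner, inner_sub_left]
  ring

lemma convex_orthant : Convex ℝ (orthant m) := by
  intro u hu v hv a b ha hb _ k
  simpa using add_nonneg (mul_nonneg ha (hu k)) (mul_nonneg hb (hv k))

lemma strongConvexOn_lagrangian (hf : StrongConvexOn Set.univ α f)
    (hg : ∀ k, ConvexOn ℝ Set.univ (g k)) (hl : l ∈ orthant m) :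
    StrongConvexOn Set.univ α (lagrangian f g l) := by
  have hsum : ConvexOn ℝ Set.univ fun x => ∑ k, l k * g k x := by
    refine ⟨convex_univ, fun x hx y hy a b ha hb hab => ?_⟩
    simp only [smul_eq_mul, Finset.mul_sum, ← Finset.sum_add_distrib]
    refine Finset.sum_le_sum fun k _ => ?_
    have := mul_le_mul_of_nonneg_left ((hg k).2 hx hy ha hb hab) (hl k)
    simp only [smul_eq_mul] at this
    linarith
  have hadd := UniformConvexOn.add hf (strongConvexOn_zero.2 hsum)
  simp only [Pi.add_def, zero_div, zero_mul, add_zero] at hadd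
  exact hadd

lemma isLeast_range_lagrangian (hx : IsMinOn (lagrangian f g l) Set.univ x) :
    IsLeast (Set.range (lagrangian f g l)) (lagrangian f g l x) :=
  ⟨⟨x, rfl⟩, by rintro _ ⟨y, rfl⟩; exact hx (Set.mem_univ y)⟩

lemma dual_eq_lagrangian (hx : IsMinOn (lagrangian f g l) Set.univ x) :
    dual f g l = lagrangian f g l x :=
  (isLeast_range_lagrangian hx).csInf_eq

lemma isMinOn_argminLagrangian (hα : 0 < α) (hf : StrongConvexOn Set.univ α f)
    (hg : ∀ k, ConvexOn ℝ Set.univ (g k)) (hl : l ∈ orthant m) :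
    IsMinOn (lagrangian f g l) Set.univ (argminLagrangian f g l) :=
  Classical.epsilon_spec (exists_isMinOn_of_strongConvexOn hα (strongConvexOn_lagrangian hf hg hl))

lemma dualWellDefined (hα : 0 < α) (hf : StrongConvexOn Set.univ α f)
    (hg : ∀ k, ConvexOn ℝ Set.univ (g k)) : DualWellDefined f g := fun l hl => by
  have hmin := isMinOn_argminLagrangian hα hf hg hl
  exact dual_eq_lagrangian hmin ▸ isLeast_range_lagrangian hmin

lemma dual_le_lagrangian (hD : DualWellDefined f g) (hl : l ∈ orthant m)
    (x : EuclideanSpace ℝ (Fin n)) : dual f g l ≤ lagrangian f g l x :=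
  (hD l hl).2 ⟨x, rfl⟩

lemma dual_le_add_inner (hD : DualWellDefined f g) (hl' : l' ∈ orthant m)
    (hx : IsMinOn (lagrangian f g l) Set.univ x) :
    dual f g l' ≤ dual f g l + inner ℝ (l' - l) (constraintVec g x) := by
  rw [dual_eq_lagrangian hx, ← lagrangian_eq_lagrangian_add_inner]
  exact dual_le_lagrangian hD hl' x

lemma concaveOn_dual (hD : DualWellDefined f g) : ConcaveOn ℝ (orthant m) (dual f g) := by
  refine ⟨convex_orthant, fun u hu v hv a b ha hb hab => ?_⟩
  obtain ⟨x, hx⟩ := (hD _ (convex_orthant hu hv ha hb hab)).1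
  calc a • dual f g u + b • dual f g v
      ≤ a * lagrangian f g u x + b * lagrangian f g v x :=
        add_le_add (mul_le_mul_of_nonneg_left (dual_le_lagrangian hD hu x) ha)
          (mul_le_mul_of_nonneg_left (dual_le_lagrangian hD hv x) hb)
    _ = lagrangian f g (a • u + b • v) x := by
        simp only [lagrangian_eq_add_inner, inner_add_left, real_inner_smul_left]
        linear_combination hab * f x
    _ = dual f g (a • u + b • v) := hx

lemma norm_constraintVec_sub_le (hβ : 0 ≤ β) (hg : ∀ k x y, |g k y - g k x| ≤ β * ‖y - x‖)
    (x y : EuclideanSpace ℝ (Fin n)) :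
    ‖constraintVec g y - constraintVec g x‖ ≤ √m * β * ‖y - x‖ := by
  rw [EuclideanSpace.norm_eq]
  refine Real.sqrt_le_iff.2 ⟨by positivity, ?_⟩
  calc ∑ k, ‖(constraintVec g y - constraintVec g x) k‖ ^ 2
      ≤ ∑ _k : Fin m, (β * ‖y - x‖) ^ 2 := by
        refine Finset.sum_le_sum fun k _ => ?_
        gcongr
        exact hg k x y
    _ = (√m * β * ‖y - x‖) ^ 2 := by
        rw [Finset.sum_const, Finset.card_univ, Fintype.card_fin, nsmul_eq_mul, mul_assoc,
          mul_pow √(m : ℝ), Real.sq_sqrt (Nat.cast_nonneg m)]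

lemma inner_constraintVec_sub_le (hβ : 0 ≤ β) (hg : ∀ k x y, |g k y - g k x| ≤ β * ‖y - x‖)
    (u : EuclideanSpace ℝ (Fin m)) (x y : EuclideanSpace ℝ (Fin n)) :
    inner ℝ u (constraintVec g x) - inner ℝ u (constraintVec g y) ≤
      ‖u‖ * (√m * β * ‖y - x‖) := by
  rw [← inner_sub_right, norm_sub_rev y x]
  exact (real_inner_le_norm _ _).trans
    (mul_le_mul_of_nonneg_left (norm_constraintVec_sub_le hβ hg y x) (norm_nonneg u))

lemma norm_sub_le_of_isMinOn_lagrangian (hP : StronglyConvexProgram f g α β)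
    (hg : ∀ k, ConvexOn ℝ Set.univ (g k)) (hl : l ∈ orthant m) (hl' : l' ∈ orthant m)
    (hx : IsMinOn (lagrangian f g l) Set.univ x) (hx' : IsMinOn (lagrangian f g l') Set.univ x') :
    ‖x' - x‖ ≤ √m * β / α * ‖l' - l‖ := by
  obtain ⟨hα, hf, hβ, hlip⟩ := hP
  have hgrowth := add_sq_le_of_isMinOn (strongConvexOn_lagrangian hf hg hl)
    (Set.mem_univ x) (Set.mem_univ x') hx
  have hgrowth' := add_sq_le_of_isMinOn (strongConvexOn_lagrangian hf hg hl')
    (Set.mem_univ x') (Set.mem_univ x) hx'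
  rw [lagrangian_eq_lagrangian_add_inner l l' x, lagrangian_eq_lagrangian_add_inner l l' x',
    norm_sub_rev x x'] at hgrowth'
  have hinner := inner_constraintVec_sub_le hβ.le hlip (l' - l) x x'
  have hmul : ‖x' - x‖ * (α * ‖x' - x‖) ≤ ‖x' - x‖ * (√m * β * ‖l' - l‖) := by linarith
  rw [div_mul_eq_mul_div, le_div_iff₀ hα, mul_comm]
  rcases (norm_nonneg (x' - x)).eq_or_lt with hzero | hpos
  · rw [← hzero, mul_zero]
    positivity
  · exact le_of_mul_le_mul_left hmul hpos

lemma dual_add_inner_sub_sq_le_dual (hP : StronglyConvexProgram f g α β)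
    (hg : ∀ k, ConvexOn ℝ Set.univ (g k)) (hV : m * β ^ 2 / α ≤ V) (hl : l ∈ orthant m)
    (hl' : l' ∈ orthant m) (hx : IsMinOn (lagrangian f g l) Set.univ x) :
    dual f g l + inner ℝ (l' - l) (constraintVec g x) - V / 2 * ‖l' - l‖ ^ 2 ≤ dual f g l' := by
  obtain ⟨hα, hf, hβ, hlip⟩ := hP
  obtain ⟨x', hx'⟩ := (dualWellDefined hα hf hg l' hl').1
  have hgrowth := add_sq_le_of_isMinOn (strongConvexOn_lagrangian hf hg hl)
    (Set.mem_univ x) (Set.mem_univ x') hx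
  have hinner := inner_constraintVec_sub_le hβ.le hlip (l' - l) x x'
  have hyoung : ‖l' - l‖ * (√m * β * ‖x' - x‖)
      ≤ α / 2 * ‖x' - x‖ ^ 2 + m * β ^ 2 / α / 2 * ‖l' - l‖ ^ 2 := by
    have hsq : 0 ≤ α / 2 * (‖x' - x‖ - √m * β / α * ‖l' - l‖) ^ 2 := by positivity
    have hexpand : α / 2 * (‖x' - x‖ - √m * β / α * ‖l' - l‖) ^ 2 = α / 2 * ‖x' - x‖ ^ 2 +
        (√m) ^ 2 * β ^ 2 / α / 2 * ‖l' - l‖ ^ 2 - ‖l' - l‖ * (√m * β * ‖x' - x‖) := by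
      field_simp
      ring
    rw [hexpand, Real.sq_sqrt (Nat.cast_nonneg m)] at hsq
    linarith
  have hmod : m * β ^ 2 / α / 2 * ‖l' - l‖ ^ 2 ≤ V / 2 * ‖l' - l‖ ^ 2 := by gcongr
  rw [← hx', lagrangian_eq_lagrangian_add_inner l l', dual_eq_lagrangian hx]
  linarith

lemma hasGradientWithinAt_of_abs_le {F : Type*} [NormedAddCommGroup F] [InnerProductSpace ℝ F]
    [CompleteSpace F] {q : F → ℝ} {K : Set F} {u G : F} {C : ℝ}
    (hC : ∀ v ∈ K, |q v - q u - inner ℝ G (v - u)| ≤ C * ‖v - u‖ ^ 2) :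
    HasGradientWithinAt q G K u := by
  rw [hasGradientWithinAt_iff_isLittleO]
  have hbound : (fun v => q v - q u - inner ℝ G (v - u)) =O[𝓝[K] u] fun v => ‖v - u‖ ^ 2 := by
    refine Asymptotics.IsBigO.of_bound C ?_
    filter_upwards [self_mem_nhdsWithin] with v hv
    simpa using hC v hv
  have hsub : Tendsto (fun v => v - u) (𝓝[K] u) (𝓝 0) := by
    simpa using (tendsto_id.sub_const u).mono_left (nhdsWithin_le_nhds (a := u) (s := K))
  exact hbound.trans_isLittleO ((Asymptotics.isLittleO_norm_pow_id one_lt_two).comp_tendsto hsub)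

lemma hasGradientWithinAt_dual (hP : StronglyConvexProgram f g α β)
    (hg : ∀ k, ConvexOn ℝ Set.univ (g k)) (hl : l ∈ orthant m) :
    HasGradientWithinAt (dual f g) (constraintVec g (argminLagrangian f g l)) (orthant m) l := by
  refine hasGradientWithinAt_of_abs_le (C := m * β ^ 2 / α / 2) fun l' hl' => ?_
  have hmin := isMinOn_argminLagrangian hP.1 hP.2.1 hg hl
  have hupper := dual_le_add_inner (dualWellDefined hP.1 hP.2.1 hg) hl' hmin
  have hlower := dual_add_inner_sub_sq_le_dual hP hg le_rfl hl hl' hmin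
  have hα := hP.1
  have hquad : 0 ≤ m * β ^ 2 / α / 2 * ‖l' - l‖ ^ 2 := by positivity
  rw [real_inner_comm, abs_le]
  constructor <;> linarith only [hupper, hlower, hquad]

lemma norm_constraintVec_argminLagrangian_sub_le (hP : StronglyConvexProgram f g α β)
    (hg : ∀ k, ConvexOn ℝ Set.univ (g k)) (hl : l ∈ orthant m) (hl' : l' ∈ orthant m) :
    ‖constraintVec g (argminLagrangian f g l') - constraintVec g (argminLagrangian f g l)‖ ≤
      m * β ^ 2 / α * ‖l' - l‖ := by
  obtain ⟨hα, hf, hβ, hlip⟩ := id hP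
  calc _ ≤ √m * β * ‖argminLagrangian f g l' - argminLagrangian f g l‖ :=
        norm_constraintVec_sub_le hβ.le hlip _ _
    _ ≤ √m * β * (√m * β / α * ‖l' - l‖) := by
        gcongr
        exact norm_sub_le_of_isMinOn_lagrangian hP hg hl hl'
          (isMinOn_argminLagrangian hα hf hg hl) (isMinOn_argminLagrangian hα hf hg hl')
    _ = √m ^ 2 * β ^ 2 / α * ‖l' - l‖ := by ring
    _ = m * β ^ 2 / α * ‖l' - l‖ := by rw [Real.sq_sqrt (Nat.cast_nonneg m)]

lemma exists_smoothDual (hP : StronglyConvexProgram f g α β)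
    (hg : ∀ k, ConvexOn ℝ Set.univ (g k)) : ∃ γ, SmoothDual f g γ := by
  have hα := hP.1
  refine ⟨m * β ^ 2 / α + 1, by positivity, _, fun l hl => hasGradientWithinAt_dual hP hg hl,
    fun l hl l' hl' => (norm_constraintVec_argminLagrangian_sub_le hP hg hl hl').trans ?_⟩
  gcongr
  linarith

lemma exists_stronglyConvexProgram (hf : ∃ α : ℝ, 0 < α ∧ StrongConvexOn Set.univ α f)
    (hg : ∀ k, ∃ β : ℝ, 0 < β ∧ ∀ x y, |g k y - g k x| ≤ β * ‖y - x‖) :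
    ∃ α β, StronglyConvexProgram f g α β := by
  obtain ⟨α, hα, hf⟩ := hf
  choose β hβ hlip using hg
  have hsum : 0 ≤ ∑ k, β k := Finset.sum_nonneg fun k _ => (hβ k).le
  refine ⟨α, 1 + ∑ k, β k, hα, hf, by positivity, fun k x y => (hlip k x y).trans ?_⟩
  gcongr
  linarith [Finset.single_le_sum (fun k _ => (hβ k).le) (Finset.mem_univ k)]

end Lagrangian

section KarushKuhnTucker

variable {n m : ℕ} {f : EuclideanSpace ℝ (Fin n) → ℝ}
  {g : Fin m → EuclideanSpace ℝ (Fin n) → ℝ} {x xs d : EuclideanSpace ℝ (Fin n)}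
  {l ls : EuclideanSpace ℝ (Fin m)} {α : ℝ}

/-- The derivatives at `x` of the constraints with index in `S` take all values jointly, that is,
their gradients are linearly independent. This is the form in which the rank conditions enter. -/
def SurjectiveDerivOn (g : Fin m → EuclideanSpace ℝ (Fin n) → ℝ) (x : EuclideanSpace ℝ (Fin n))
    (S : Set (Fin m)) : Prop :=
  ∀ b : Fin m → ℝ, ∃ d, ∀ k ∈ S, fderiv ℝ (g k) x d = b k

lemma SurjectiveDerivOn.mono {S T : Set (Fin m)} (hT : SurjectiveDerivOn g x T) (hST : S ⊆ T) :
    SurjectiveDerivOn g x S := fun b =>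
  (hT b).imp fun _ hd k hk => hd k (hST hk)

lemma jacobian_mulVec (x : EuclideanSpace ℝ (Fin n)) (v : Fin n → ℝ) (k : Fin m) :
    (jacobian g x).mulVec v k = fderiv ℝ (g k) x (WithLp.toLp 2 v) := by
  have hbasis : (WithLp.toLp 2 v : EuclideanSpace ℝ (Fin n)) =
      ∑ i, v i • EuclideanSpace.single i (1 : ℝ) := by
    ext j
    simp [Finset.sum_apply, Pi.single_apply]
  rw [hbasis, map_sum]
  simp [Matrix.mulVec, dotProduct, jacobian, mul_comm]

lemma surjectiveDerivOn_range_of_rank_eq {ι : Type*} [Fintype ι] {σ : ι → Fin m}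
    (hrank : ((jacobian g x).submatrix σ id).rank = Fintype.card ι) :
    SurjectiveDerivOn g x (Set.range σ) := by
  intro b
  have hrange : LinearMap.range ((jacobian g x).submatrix σ id).mulVecLin = ⊤ :=
    Submodule.eq_top_of_finrank_eq (hrank.trans (Module.finrank_pi ℝ).symm)
  obtain ⟨v, hv⟩ := LinearMap.range_eq_top.1 hrange fun i => b (σ i)
  refine ⟨WithLp.toLp 2 v, ?_⟩
  rintro _ ⟨i, rfl⟩
  rw [← jacobian_mulVec]
  exact congrFun hv i

lemma surjectiveDerivOn_active
    (hrank : (activeJacobian g x).rank = Nat.card {k : Fin m // g k x = 0}) :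
    SurjectiveDerivOn g x {k | g k x = 0} := by
  classical
  simpa using surjectiveDerivOn_range_of_rank_eq (hrank.trans Nat.card_eq_fintype_card)

lemma surjectiveDerivOn_univ (hrank : (jacobian g x).rank = m) :
    SurjectiveDerivOn g x Set.univ := by
  simpa using surjectiveDerivOn_range_of_rank_eq (g := g) (x := x) (σ := id) (by simpa using hrank)

lemma eventually_add_smul_nonpos {E : Type*} [NormedAddCommGroup E] [NormedSpace ℝ E] {h : E → ℝ}
    {x e : E} (hh : DifferentiableAt ℝ h x) (hx : h x ≤ 0) (he : h x = 0 → fderiv ℝ h x e < 0) :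
    ∀ᶠ s : ℝ in 𝓝[>] 0, h (x + s • e) ≤ 0 := by
  rcases hx.eq_or_lt with hactive | hinactive
  · have hlim := (hh.hasFDerivAt.hasLineDerivAt e).tendsto_slope_zero_right
    filter_upwards [hlim.eventually_lt_const (he hactive), self_mem_nhdsWithin] with s hslope hs
    rw [hactive, sub_zero, smul_eq_mul] at hslope
    exact (neg_of_mul_neg_right hslope (inv_nonneg.2 (Set.mem_Ioi.1 hs).le)).le
  · have hline : Continuous fun s : ℝ => x + s • e := by fun_prop
    have hlim : Tendsto (fun s : ℝ => h (x + s • e)) (𝓝[>] 0) (𝓝 (h x)) := by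
      refine hh.continuousAt.tendsto.comp ?_
      simpa using (hline.tendsto 0).mono_left nhdsWithin_le_nhds
    filter_upwards [hlim.eventually_lt_const hinactive] with s hs using hs.le

lemma IsSolution.fderiv_nonneg_of_forall_neg (hxs : IsSolution f g xs)
    (hf : DifferentiableAt ℝ f xs) (hg : ∀ k, DifferentiableAt ℝ (g k) xs)
    (hd : ∀ k, g k xs = 0 → fderiv ℝ (g k) xs d < 0) : 0 ≤ fderiv ℝ f xs d := by
  have hfeasible : ∀ᶠ s : ℝ in 𝓝[>] 0, xs + s • d ∈ feasible g :=
    eventually_all.2 fun k => eventually_add_smul_nonpos (hg k) (hxs.1 k) (hd k)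
  have htangent := mem_posTangentConeAt_of_frequently_mem hfeasible.frequently
  exact hxs.2.localize.hasFDerivWithinAt_nonneg hf.hasFDerivAt.hasFDerivWithinAt htangent

lemma IsSolution.fderiv_nonneg (hxs : IsSolution f g xs) (hf : DifferentiableAt ℝ f xs)
    (hg : ∀ k, DifferentiableAt ℝ (g k) xs) (hsurj : SurjectiveDerivOn g xs {k | g k xs = 0})
    (hd : ∀ k, g k xs = 0 → fderiv ℝ (g k) xs d ≤ 0) : 0 ≤ fderiv ℝ f xs d := by
  obtain ⟨e, he⟩ := hsurj fun _ => -1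
  have hcont : Continuous fun r : ℝ => fderiv ℝ f xs (d + r • e) := by fun_prop
  have hlim : Tendsto (fun r : ℝ => fderiv ℝ f xs (d + r • e)) (𝓝[>] 0)
      (𝓝 (fderiv ℝ f xs d)) := by
    simpa using (hcont.tendsto 0).mono_left nhdsWithin_le_nhds
  refine ge_of_tendsto hlim ?_
  filter_upwards [self_mem_nhdsWithin] with r (hr : 0 < r)
  refine hxs.fderiv_nonneg_of_forall_neg hf hg fun k hk => ?_
  rw [map_add, map_smul, he k hk, smul_eq_mul]
  linarith [hd k hk]

lemma IsSolution.fderiv_eq_zero (hxs : IsSolution f g xs) (hf : DifferentiableAt ℝ f xs)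
    (hg : ∀ k, DifferentiableAt ℝ (g k) xs) (hsurj : SurjectiveDerivOn g xs {k | g k xs = 0})
    (hd : ∀ k, g k xs = 0 → fderiv ℝ (g k) xs d = 0) : fderiv ℝ f xs d = 0 := by
  have hneg : 0 ≤ fderiv ℝ f xs (-d) := hxs.fderiv_nonneg hf hg hsurj fun k hk => by
    rw [map_neg, hd k hk, neg_zero]
  rw [map_neg] at hneg
  exact le_antisymm (by linarith) (hxs.fderiv_nonneg hf hg hsurj fun k hk => (hd k hk).le)

lemma IsSolution.exists_multiplier (hxs : IsSolution f g xs) (hf : DifferentiableAt ℝ f xs)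
    (hg : ∀ k, DifferentiableAt ℝ (g k) xs) (hsurj : SurjectiveDerivOn g xs {k | g k xs = 0}) :
    ∃ l ∈ orthant m, (∀ k, l k * g k xs = 0) ∧
      fderiv ℝ f xs + ∑ k, l k • fderiv ℝ (g k) xs = 0 := by
  classical
  choose d hd using fun j : Fin m => hsurj fun k => if k = j then -1 else 0
  let l : EuclideanSpace ℝ (Fin m) :=
    WithLp.toLp 2 fun k => if g k xs = 0 then fderiv ℝ f xs (d k) else 0
  have hl (k : Fin m) : l k = if g k xs = 0 then fderiv ℝ f xs (d k) else 0 := rfl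
  refine ⟨l, fun k => ?_, fun k => by by_cases hk : g k xs = 0 <;> simp [hl, hk], ?_⟩
  · rw [hl]
    split_ifs with hk
    · refine hxs.fderiv_nonneg hf hg hsurj fun j hj => ?_
      rw [hd k j hj]
      split_ifs <;> norm_num
    · exact le_rfl
  · ext v
    let w := v + ∑ k, (if g k xs = 0 then fderiv ℝ (g k) xs v else 0) • d k
    have htangent (j : Fin m) (hj : g j xs = 0) : fderiv ℝ (g j) xs w = 0 := by
      simp only [w, map_add, map_sum, map_smul, smul_eq_mul, hd _ j hj]
      simp [hj]
    rw [zero_apply, ← hxs.fderiv_eq_zero hf hg hsurj htangent]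
    simp only [w, map_add, map_sum, map_smul, add_apply, sum_apply, smul_apply, hl]
    congr! 2 with k
    split_ifs <;> simp [mul_comm]

lemma hasFDerivAt_lagrangian (hf : DifferentiableAt ℝ f x) (hg : ∀ k, DifferentiableAt ℝ (g k) x)
    (l : EuclideanSpace ℝ (Fin m)) :
    HasFDerivAt (lagrangian f g l) (fderiv ℝ f x + ∑ k, l k • fderiv ℝ (g k) x) x :=
  hf.hasFDerivAt.add
    (HasFDerivAt.fun_sum fun k (_ : k ∈ Finset.univ) => (hg k).hasFDerivAt.const_mul (l k))

lemma IsSolution.isLeast (hxs : IsSolution f g xs) : IsLeast (f '' feasible g) (f xs) :=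
  ⟨⟨xs, hxs.1, rfl⟩, by rintro _ ⟨y, hy, rfl⟩; exact hxs.2 hy⟩

lemma IsSolution.strongDuality (hxs : IsSolution f g xs) (hα : 0 < α)
    (hfc : StrongConvexOn Set.univ α f) (hgc : ∀ k, ConvexOn ℝ Set.univ (g k))
    (hf : DifferentiableAt ℝ f xs) (hg : ∀ k, DifferentiableAt ℝ (g k) xs)
    (hsurj : SurjectiveDerivOn g xs {k | g k xs = 0}) : StrongDuality f g := by
  obtain ⟨l, hl, hslack, hstationary⟩ := hxs.exists_multiplier hf hg hsurj
  have hconvex : ConvexOn ℝ Set.univ (lagrangian f g l) :=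
    strongConvexOn_zero.1 ((strongConvexOn_lagrangian hfc hgc hl).mono hα.le)
  have hmin : IsMinOn (lagrangian f g l) Set.univ xs :=
    isMinOn_of_convexOn_of_hasFDerivAt_zero hconvex (hstationary ▸ hasFDerivAt_lagrangian hf hg l)
  have hdual : dual f g l = f xs := by
    rw [dual_eq_lagrangian hmin, lagrangian, Finset.sum_eq_zero fun k _ => hslack k, add_zero]
  exact ⟨l, hl, dualWellDefined hα hfc hgc l hl, hdual ▸ hxs.isLeast⟩

lemma sum_mul_nonpos (hl : l ∈ orthant m) (hx : x ∈ feasible g) : ∑ k, l k * g k x ≤ 0 :=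
  Finset.sum_nonpos fun k _ => mul_nonpos_of_nonneg_of_nonpos (hl k) (hx k)

lemma dual_le_of_mem_feasible (hD : DualWellDefined f g) (hl : l ∈ orthant m)
    (hx : x ∈ feasible g) : dual f g l ≤ f x :=
  (dual_le_lagrangian hD hl x).trans (add_le_of_nonpos_right (sum_mul_nonpos hl hx))

lemma IsLagrangeMultiplier.isMaxOn (hls : IsLagrangeMultiplier f g ls) (hD : DualWellDefined f g) :
    IsMaxOn (dual f g) (orthant m) ls := by
  intro l hl
  obtain ⟨x, hx, hfx⟩ := hls.2.2.1
  exact (dual_le_of_mem_feasible hD hl hx).trans hfx.le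

lemma IsLagrangeMultiplier.dual_eq (hls : IsLagrangeMultiplier f g ls)
    (hxs : IsSolution f g xs) : dual f g ls = f xs :=
  hls.2.2.unique hxs.isLeast

lemma IsLagrangeMultiplier.sum_mul_eq_zero (hls : IsLagrangeMultiplier f g ls)
    (hxs : IsSolution f g xs) : ∑ k, ls k * g k xs = 0 := by
  have hle : f xs ≤ lagrangian f g ls xs := hls.dual_eq hxs ▸ hls.2.1.2 ⟨xs, rfl⟩
  exact le_antisymm (sum_mul_nonpos hls.1 hxs.1) (le_add_iff_nonneg_right _ |>.1 hle)

lemma IsLagrangeMultiplier.mul_eq_zero (hls : IsLagrangeMultiplier f g ls)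
    (hxs : IsSolution f g xs) (k : Fin m) : ls k * g k xs = 0 :=
  (Finset.sum_eq_zero_iff_of_nonpos fun j _ =>
    mul_nonpos_of_nonneg_of_nonpos (hls.1 j) (hxs.1 j)).1 (hls.sum_mul_eq_zero hxs) k
    (Finset.mem_univ k)

lemma IsLagrangeMultiplier.isMinOn (hls : IsLagrangeMultiplier f g ls)
    (hxs : IsSolution f g xs) : IsMinOn (lagrangian f g ls) Set.univ xs := by
  intro y _
  have hvalue : lagrangian f g ls xs = dual f g ls := by
    rw [hls.dual_eq hxs, lagrangian, hls.sum_mul_eq_zero hxs, add_zero]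
  exact hvalue.trans_le (hls.2.1.2 ⟨y, rfl⟩)

end KarushKuhnTucker

section SecondOrder

open ContinuousLinearMap

lemma exists_eventually_norm_sub_sub_fderiv_le {E F : Type*} [NormedAddCommGroup E]
    [NormedSpace ℝ E] [NormedAddCommGroup F] [NormedSpace ℝ F] {h : E → F} {x₀ : E}
    (hh : ContDiffAt ℝ 2 h x₀) :
    ∃ M : ℝ, ∀ᶠ p : E × E in 𝓝 (x₀, x₀),
      ‖h p.2 - h p.1 - fderiv ℝ h p.1 (p.2 - p.1)‖ ≤ M * ‖p.2 - p.1‖ ^ 2 := by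
  obtain ⟨K, t, ht, hlip⟩ := (hh.fderiv_right (m := 1) (by norm_num)).exists_lipschitzOnWith
  have hdiff : ∀ᶠ x in 𝓝 x₀, DifferentiableAt ℝ h x :=
    (hh.eventually (by simp)).mono fun _ hx => hx.differentiableAt (by norm_num)
  obtain ⟨r, hr, hball⟩ := Metric.mem_nhds_iff.1 (inter_mem ht hdiff)
  refine ⟨K, ?_⟩
  filter_upwards [prod_mem_nhds (Metric.ball_mem_nhds x₀ hr) (Metric.ball_mem_nhds x₀ hr)]
  rintro ⟨x, y⟩ ⟨hx, hy⟩
  have htaylor := Convex.norm_image_sub_le_of_norm_hasFDerivWithin_le' (φ := fderiv ℝ h x)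
    (s := Metric.ball x₀ r ∩ Metric.closedBall x ‖y - x‖)
    (fun z hz => (hball hz.1).2.hasFDerivAt.hasFDerivWithinAt)
    (fun z hz => (hlip.norm_sub_le (hball hz.1).1 (hball hx).1).trans
      (mul_le_mul_of_nonneg_left (mem_closedBall_iff_norm.1 hz.2) K.2))
    ((convex_ball x₀ r).inter (convex_closedBall x _))
    ⟨hx, Metric.mem_closedBall_self (norm_nonneg _)⟩ ⟨hy, mem_closedBall_iff_norm.2 le_rfl⟩
  rwa [mul_assoc, ← sq] at htaylor

lemma eventually_le_norm_apply {X E F : Type*} [TopologicalSpace X] [NormedAddCommGroup E]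
    [NormedSpace ℝ E] [NormedAddCommGroup F] [NormedSpace ℝ F] {A : X → E →L[ℝ] F} {x₀ : X}
    (hA : ContinuousAt A x₀) {U : Set E} {c c' : ℝ} (hc : c' < c)
    (hU : ∀ u ∈ U, c * ‖u‖ ≤ ‖A x₀ u‖) : ∀ᶠ x in 𝓝 x₀, ∀ u ∈ U, c' * ‖u‖ ≤ ‖A x u‖ := by
  filter_upwards [hA.eventually (Metric.ball_mem_nhds _ (sub_pos.2 hc))] with x hx u hu
  have hclose : ‖(A x₀ - A x) u‖ ≤ (c - c') * ‖u‖ :=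
    (A x₀ - A x).le_of_opNorm_le (by rw [norm_sub_rev]; exact (mem_ball_iff_norm.1 hx).le) u
  rw [sub_apply] at hclose
  linarith [hU u hu, norm_le_insert' (A x₀ u) (A x u)]

variable {E F : Type*} [NormedAddCommGroup E] [InnerProductSpace ℝ E] [NormedAddCommGroup F]
  [InnerProductSpace ℝ F] {f : E → ℝ} {h : E → F} {x₀ : E}

lemma fderiv_add_inner_eq_zero_of_isMinOn {x : E} {ν : F} (hf : DifferentiableAt ℝ f x)
    (hh : DifferentiableAt ℝ h x) (hmin : IsMinOn (fun y => f y + inner ℝ ν (h y)) Set.univ x)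
    (v : E) : fderiv ℝ f x v + inner ℝ ν (fderiv ℝ h x v) = 0 := by
  have hderiv : HasFDerivAt (fun y => f y + inner ℝ ν (h y))
      (fderiv ℝ f x + (innerSL ℝ ν).comp (fderiv ℝ h x)) x :=
    hf.hasFDerivAt.add ((innerSL ℝ ν).hasFDerivAt.comp x hh.hasFDerivAt)
  have hzero := (hmin.isLocalMin univ_mem).hasFDerivAt_eq_zero hderiv
  simpa using congr($hzero v)

variable [CompleteSpace E] [CompleteSpace F]

lemma add_inner_gradient_step_le {f' : E →L[ℝ] ℝ} {A : E →L[ℝ] F} {x : E} {u ν : F} {s M R : ℝ}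
    (hf : ‖f (x - s • adjoint A u) - f x - f' (x - s • adjoint A u - x)‖ ≤
      M * ‖x - s • adjoint A u - x‖ ^ 2)
    (hh : ‖h (x - s • adjoint A u) - h x - A (x - s • adjoint A u - x)‖ ≤
      M * ‖x - s • adjoint A u - x‖ ^ 2)
    (hstationary : ∀ v, f' v + inner ℝ ν (A v) = 0) (hR : ‖ν + u‖ ≤ R) :
    f (x - s • adjoint A u) + inner ℝ (ν + u) (h (x - s • adjoint A u)) ≤
      f x + inner ℝ (ν + u) (h x) - (s - M * (1 + R) * s ^ 2) * ‖adjoint A u‖ ^ 2 := by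
  have hstep : x - s • adjoint A u - x = -(s • adjoint A u) := by abel
  have hdescent : inner ℝ u (A (-(s • adjoint A u))) = -(s * ‖adjoint A u‖ ^ 2) := by
    rw [← adjoint_inner_left, inner_neg_right, real_inner_smul_right, real_inner_self_eq_norm_sq]
  have hnorm : ‖-(s • adjoint A u)‖ ^ 2 = s ^ 2 * ‖adjoint A u‖ ^ 2 := by
    rw [norm_neg, norm_smul, mul_pow, Real.norm_eq_abs, sq_abs]
  rw [hstep, hnorm] at hf hh
  have hinner : inner ℝ (ν + u) (h (x - s • adjoint A u) - h x - A (-(s • adjoint A u))) ≤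
      R * (M * (s ^ 2 * ‖adjoint A u‖ ^ 2)) :=
    (real_inner_le_norm _ _).trans (mul_le_mul hR hh (norm_nonneg _) ((norm_nonneg _).trans hR))
  rw [inner_sub_right, inner_sub_right, inner_add_left ν u (A _), hdescent] at hinner
  linarith [Real.le_norm_self _ |>.trans hf, hstationary (-(s • adjoint A u))]

lemma tendsto_sub_smul_adjoint_fderiv (hh : ContDiffAt ℝ 1 h x₀) (s : ℝ) :
    Tendsto (fun p : E × F => p.1 - s • adjoint (fderiv ℝ h p.1) p.2) (𝓝 (x₀, 0)) (𝓝 x₀) := by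
  have hadj : ContinuousAt (fun x => adjoint (fderiv ℝ h x)) x₀ :=
    adjoint.continuous.continuousAt.comp (hh.continuousAt_fderiv one_ne_zero)
  have hstep : ContinuousAt (fun p : E × F => p.1 - s • adjoint (fderiv ℝ h p.1) p.2) (x₀, 0) :=
    continuousAt_fst.sub
      (((hadj.comp (x := (x₀, (0 : F))) continuousAt_fst).clm_apply continuousAt_snd).const_smul s)
  simpa using hstep.tendsto

-- A step `-s • A†u` from a minimizer of `f + ⟪ν, h⟫` is first-order neutral for `f + ⟪ν, h⟫` and
-- changes `⟪u, h⟫` by `-s ‖A†u‖²`, which beats the second-order errors once `s` is small.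
lemma exists_tendsto_descent (hf : ContDiffAt ℝ 2 f x₀) (hh : ContDiffAt ℝ 2 h x₀) {U : Set F}
    {c : ℝ} (hc : 0 < c) (hU : ∀ u ∈ U, c * ‖u‖ ≤ ‖adjoint (fderiv ℝ h x₀) u‖) (R : ℝ) :
    ∃ (y : E × F → E) (κ : ℝ), Tendsto y (𝓝 (x₀, 0)) (𝓝 x₀) ∧ 0 < κ ∧
      ∀ᶠ p : E × F in 𝓝 (x₀, 0), p.2 ∈ U → ∀ ν, ‖ν‖ ≤ R →
        IsMinOn (fun z => f z + inner ℝ ν (h z)) Set.univ p.1 →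
        f (y p) + inner ℝ (ν + p.2) (h (y p)) ≤
          f p.1 + inner ℝ (ν + p.2) (h p.1) - κ * ‖p.2‖ ^ 2 := by
  obtain ⟨M₁, hM₁⟩ := exists_eventually_norm_sub_sub_fderiv_le hf
  obtain ⟨M₂, hM₂⟩ := exists_eventually_norm_sub_sub_fderiv_le hh
  obtain ⟨M, hM⟩ := exists_gt (max 0 (max M₁ M₂))
  obtain ⟨hM₀, hM₁', hM₂'⟩ : 0 < M ∧ M₁ < M ∧ M₂ < M := by simpa only [max_lt_iff] using hM
  set s : ℝ := 1 / (2 * (M * (1 + (|R| + 1)))) with hs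
  have : 0 < s := by positivity
  have hadj : ContinuousAt (fun x => adjoint (fderiv ℝ h x)) x₀ :=
    adjoint.continuous.continuousAt.comp (hh.continuousAt_fderiv two_ne_zero)
  let y : E × F → E := fun p => p.1 - s • adjoint (fderiv ℝ h p.1) p.2
  have hy : Tendsto y (𝓝 (x₀, 0)) (𝓝 x₀) :=
    tendsto_sub_smul_adjoint_fderiv (hh.of_le one_le_two) s
  have hfst : Tendsto Prod.fst (𝓝 (x₀, (0 : F))) (𝓝 x₀) := continuousAt_fst
  have hpair : Tendsto (fun p => (p.1, y p)) (𝓝 (x₀, 0)) (𝓝 (x₀, x₀)) := by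
    simpa only [nhds_prod_eq] using hfst.prodMk hy
  have hsnd : ∀ᶠ p : E × F in 𝓝 (x₀, 0), ‖p.2‖ < 1 :=
    (continuousAt_snd.norm.tendsto).eventually_lt_const (by simp)
  have hfd : ∀ᶠ x in 𝓝 x₀, DifferentiableAt ℝ f x ∧ DifferentiableAt ℝ h x :=
    ((hf.eventually (by simp)).and (hh.eventually (by simp))).mono fun _ hx =>
      ⟨hx.1.differentiableAt (by norm_num), hx.2.differentiableAt (by norm_num)⟩
  refine ⟨y, s / 2 * (c / 2) ^ 2, hy, by positivity, ?_⟩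
  filter_upwards [hpair.eventually hM₁, hpair.eventually hM₂, hsnd, hfst.eventually hfd,
    hfst.eventually (eventually_le_norm_apply hadj (half_lt_self hc) hU)]
    with p hfp hhp hp hdiff hlow hpU ν hν hmin
  have hR : ‖ν + p.2‖ ≤ |R| + 1 := (norm_add_le _ _).trans
    (add_le_add (hν.trans (le_abs_self R)) hp.le)
  have hstep := add_inner_gradient_step_le (M := M) (hfp.trans (by gcongr))
    (hhp.trans (by gcongr)) (fderiv_add_inner_eq_zero_of_isMinOn hdiff.1 hdiff.2 hmin) hR
  have hcoef : s - M * (1 + (|R| + 1)) * s ^ 2 = s / 2 := by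
    rw [hs]
    field_simp
    ring
  rw [hcoef] at hstep
  have hlow' : s / 2 * (c / 2 * ‖p.2‖) ^ 2 ≤ s / 2 * ‖adjoint (fderiv ℝ h p.1) p.2‖ ^ 2 := by
    gcongr
    exact hlow _ hpU
  linarith

end SecondOrder

section DualCurvature

variable {n m : ℕ} {f : EuclideanSpace ℝ (Fin n) → ℝ}
  {g : Fin m → EuclideanSpace ℝ (Fin n) → ℝ} {x xs : EuclideanSpace ℝ (Fin n)}
  {S : Set (Fin m)} {α β : ℝ}

/-- The multipliers supported on the constraints with index in `S`. -/
def supportedOn (S : Set (Fin m)) : Submodule ℝ (EuclideanSpace ℝ (Fin m)) where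
  carrier := {u | ∀ k ∉ S, u k = 0}
  zero_mem' := fun _ _ => rfl
  add_mem' := fun hu hv k hk => by simp [hu k hk, hv k hk]
  smul_mem' := fun c u hu k hk => by simp [hu k hk]

/-- The orthogonal projection onto `supportedOn S`: coordinates outside `S` are set to `0`. -/
noncomputable def coordRestrict (S : Set (Fin m)) (v : EuclideanSpace ℝ (Fin m)) :
    EuclideanSpace ℝ (Fin m) :=
  WithLp.toLp 2 (S.indicator v)

@[simp] lemma coordRestrict_apply (v : EuclideanSpace ℝ (Fin m)) (k : Fin m) :
    coordRestrict S v k = S.indicator v k := rfl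

lemma coordRestrict_mem_supportedOn (v : EuclideanSpace ℝ (Fin m)) :
    coordRestrict S v ∈ supportedOn S :=
  fun _ hk => Set.indicator_of_notMem hk v

lemma coordRestrict_add_coordRestrict_compl (S : Set (Fin m)) (v : EuclideanSpace ℝ (Fin m)) :
    coordRestrict S v + coordRestrict Sᶜ v = v := by
  ext k
  exact Set.indicator_self_add_compl_apply S v k

lemma norm_coordRestrict_sq_add (S : Set (Fin m)) (v : EuclideanSpace ℝ (Fin m)) :
    ‖coordRestrict S v‖ ^ 2 + ‖coordRestrict Sᶜ v‖ ^ 2 = ‖v‖ ^ 2 := by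
  simp only [EuclideanSpace.real_norm_sq_eq, ← Finset.sum_add_distrib]
  refine Finset.sum_congr rfl fun k _ => ?_
  by_cases hk : k ∈ S <;> simp [hk]

lemma norm_coordRestrict_le (v : EuclideanSpace ℝ (Fin m)) : ‖coordRestrict S v‖ ≤ ‖v‖ :=
  (pow_le_pow_iff_left₀ (norm_nonneg _) (norm_nonneg _) two_ne_zero).1 <|
    le_of_add_le_of_nonneg_left (norm_coordRestrict_sq_add S v).le (sq_nonneg _)

lemma differentiableAt_constraintVec (hg : ∀ k, DifferentiableAt ℝ (g k) x) :
    DifferentiableAt ℝ (constraintVec g) x :=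
  differentiableAt_euclidean.2 hg

lemma contDiffAt_constraintVec {N : WithTop ℕ∞} (hg : ∀ k, ContDiffAt ℝ N (g k) x) :
    ContDiffAt ℝ N (constraintVec g) x :=
  contDiffAt_euclidean.2 hg

lemma fderiv_constraintVec_apply (hg : ∀ k, DifferentiableAt ℝ (g k) x)
    (d : EuclideanSpace ℝ (Fin n)) (k : Fin m) :
    fderiv ℝ (constraintVec g) x d k = fderiv ℝ (g k) x d := by
  have hcoord := (EuclideanSpace.proj (𝕜 := ℝ) k).hasFDerivAt.comp x
    (differentiableAt_constraintVec hg).hasFDerivAt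
  exact congr($(hcoord.fderiv.symm) d)

lemma exists_pos_mul_norm_le_norm_adjoint {E F : Type*} [NormedAddCommGroup E]
    [InnerProductSpace ℝ E] [CompleteSpace E] [NormedAddCommGroup F] [InnerProductSpace ℝ F]
    [CompleteSpace F] {A : E →L[ℝ] F} {W : Submodule ℝ F} [FiniteDimensional ℝ W]
    (hA : ∀ w ∈ W, ∃ e, inner ℝ w (A e) = ‖w‖ ^ 2) :
    ∃ c : ℝ, 0 < c ∧ ∀ w ∈ W, c * ‖w‖ ≤ ‖ContinuousLinearMap.adjoint A w‖ := by
  have hker : ((ContinuousLinearMap.adjoint A).toLinearMap.domRestrict W).ker = ⊥ := by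
    refine LinearMap.ker_eq_bot'.2 fun w hw => ?_
    obtain ⟨e, he⟩ := hA w w.2
    rw [← ContinuousLinearMap.adjoint_inner_left,
      show ContinuousLinearMap.adjoint A w = 0 from hw, inner_zero_left] at he
    simpa using he.symm
  obtain ⟨K, hK, hanti⟩ := LinearMap.exists_antilipschitzWith _ hker
  refine ⟨(K : ℝ)⁻¹, by positivity, fun w hw => ?_⟩
  rw [inv_mul_le_iff₀ (by positivity)]
  simpa using hanti.le_mul_dist ⟨w, hw⟩ 0

lemma SurjectiveDerivOn.exists_pos_mul_norm_le (hS : SurjectiveDerivOn g x S)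
    (hg : ∀ k, DifferentiableAt ℝ (g k) x) :
    ∃ c : ℝ, 0 < c ∧ ∀ u ∈ supportedOn S,
      c * ‖u‖ ≤ ‖ContinuousLinearMap.adjoint (fderiv ℝ (constraintVec g) x) u‖ := by
  refine exists_pos_mul_norm_le_norm_adjoint fun u hu => ?_
  obtain ⟨e, he⟩ := hS u
  refine ⟨e, ?_⟩
  rw [inner_eq_sum, EuclideanSpace.real_norm_sq_eq]
  refine Finset.sum_congr rfl fun k _ => ?_
  by_cases hk : k ∈ S
  · rw [fderiv_constraintVec_apply hg, he k hk, sq]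
  · rw [hu k hk, zero_mul, zero_pow two_ne_zero]

lemma SurjectiveDerivOn.exists_lagrangian_descent (hS : SurjectiveDerivOn g xs S)
    (hf : ContDiffAt ℝ 2 f xs) (hg : ∀ k, ContDiffAt ℝ 2 (g k) xs) (R : ℝ) :
    ∃ (y : EuclideanSpace ℝ (Fin n) × EuclideanSpace ℝ (Fin m) → EuclideanSpace ℝ (Fin n)) (κ : ℝ),
      Tendsto y (𝓝 (xs, 0)) (𝓝 xs) ∧ 0 < κ ∧ ∀ᶠ p in 𝓝 (xs, 0), p.2 ∈ supportedOn S →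
        ∀ ν, ‖ν‖ ≤ R → IsMinOn (lagrangian f g ν) Set.univ p.1 →
          lagrangian f g (ν + p.2) (y p) ≤ lagrangian f g (ν + p.2) p.1 - κ * ‖p.2‖ ^ 2 := by
  have hlag (ν) : lagrangian f g ν = fun x => f x + inner ℝ ν (constraintVec g x) :=
    funext (lagrangian_eq_add_inner ν)
  obtain ⟨c, hc, hlow⟩ := hS.exists_pos_mul_norm_le fun k => (hg k).differentiableAt two_ne_zero
  simp only [hlag]
  exact exists_tendsto_descent hf (contDiffAt_constraintVec hg) hc hlow R

lemma exists_eventually_inactive_le_neg (hg : ∀ k, ContinuousAt (g k) xs)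
    (hxs : xs ∈ feasible g) :
    ∃ δ : ℝ, 0 < δ ∧ ∀ᶠ y in 𝓝 xs, ∀ k, g k xs ≠ 0 → g k y ≤ -δ := by
  have hslack : ∀ᶠ δ : ℝ in 𝓝[>] 0, ∀ k, g k xs ≠ 0 → g k xs < -δ := by
    refine eventually_all.2 fun k => eventually_imp_distrib_left.2 fun hk => ?_
    filter_upwards [Ioo_mem_nhdsGT (neg_pos.2 (lt_of_le_of_ne (hxs k) hk))] with δ hδ
    exact lt_neg_of_lt_neg hδ.2
  obtain ⟨δ, hδ, hδ₀⟩ := (hslack.and self_mem_nhdsWithin).exists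
  exact ⟨δ, hδ₀, eventually_all.2 fun k => eventually_imp_distrib_left.2 fun hk =>
    ((hg k).eventually_lt continuousAt_const (hδ k hk)).mono fun _ => le_of_lt⟩

lemma inner_le_neg_mul_norm_sq {w v : EuclideanSpace ℝ (Fin m)} {δ : ℝ} (hδ : 0 ≤ δ)
    (hw : ∀ k, w k ∈ Set.Icc (0 : ℝ) 1) (hv : ∀ k, w k ≠ 0 → v k ≤ -δ) :
    inner ℝ w v ≤ -(δ * ‖w‖ ^ 2) := by
  rw [inner_eq_sum, EuclideanSpace.real_norm_sq_eq, Finset.mul_sum, ← Finset.sum_neg_distrib]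
  refine Finset.sum_le_sum fun k _ => ?_
  obtain ⟨hw₀, hw₁⟩ := hw k
  by_cases hk : w k = 0
  · simp [hk]
  calc w k * v k ≤ w k * -δ := mul_le_mul_of_nonneg_left (hv k hk) hw₀
    _ ≤ -(δ * w k ^ 2) := by nlinarith [mul_nonneg hδ (mul_nonneg hw₀ (sub_nonneg.2 hw₁))]

lemma IsLagrangeMultiplier.dual_add_le {ls l : EuclideanSpace ℝ (Fin m)}
    (hls : IsLagrangeMultiplier f g ls) (hD : DualWellDefined f g) (hxs : IsSolution f g xs)
    (hl : l ∈ orthant m) (hdist : ‖l - ls‖ ≤ 1) {y : EuclideanSpace ℝ (Fin n)} {κ δ : ℝ}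
    (hδ : 0 ≤ δ) (hslack : ∀ k, g k xs ≠ 0 → g k y ≤ -δ)
    (hdescent : lagrangian f g (ls + coordRestrict {k | g k xs = 0} (l - ls)) y ≤
      lagrangian f g (ls + coordRestrict {k | g k xs = 0} (l - ls)) xs -
        κ * ‖coordRestrict {k | g k xs = 0} (l - ls)‖ ^ 2) :
    dual f g l + min κ δ * ‖l - ls‖ ^ 2 ≤ dual f g ls := by
  set S : Set (Fin m) := {k | g k xs = 0}
  set u := coordRestrict S (l - ls)
  set w := coordRestrict Sᶜ (l - ls)
  have hw : ∀ k, w k ∈ Set.Icc (0 : ℝ) 1 := fun k => by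
    by_cases hk : g k xs = 0
    · simp [w, S, hk]
    · have hlsk : ls k = 0 := (_root_.mul_eq_zero.1 (hls.mul_eq_zero hxs k)).resolve_right hk
      have hlk := (le_abs_self _).trans ((PiLp.norm_apply_le (l - ls) k).trans hdist)
      simpa [w, S, hk, hlsk] using And.intro (hl k) (by simpa [hlsk] using hlk)
  have hwy : inner ℝ w (constraintVec g y) ≤ -(δ * ‖w‖ ^ 2) :=
    inner_le_neg_mul_norm_sq hδ hw fun k hk => hslack k fun hgk => hk (by simp [w, S, hgk])
  have huxs : inner ℝ u (constraintVec g xs) = 0 := by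
    rw [inner_eq_sum]
    refine Finset.sum_eq_zero fun k _ => ?_
    by_cases hk : g k xs = 0 <;> simp [u, S, hk]
  have hl_sub : l - (ls + u) = w := by
    rw [← sub_sub, ← coordRestrict_add_coordRestrict_compl S (l - ls), add_sub_cancel_left]
  have hdual := dual_le_lagrangian hD hl y
  rw [lagrangian_eq_lagrangian_add_inner (ls + u), hl_sub] at hdual
  rw [lagrangian_eq_lagrangian_add_inner ls (ls + u) xs, add_sub_cancel_left, huxs, add_zero,
    ← dual_eq_lagrangian (hls.isMinOn hxs)] at hdescent
  rw [← norm_coordRestrict_sq_add S (l - ls), mul_add]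
  have hκ := mul_le_mul_of_nonneg_right (min_le_left κ δ) (sq_nonneg ‖u‖)
  have hδ' := mul_le_mul_of_nonneg_right (min_le_right κ δ) (sq_nonneg ‖w‖)
  linarith

-- The active coordinates of `l - ls` lower the dual function through the curvature of the
-- Lagrangian, the inactive ones through the slack of their constraints.
lemma locallyQuadraticDual (hD : DualWellDefined f g) (hf : ContDiffAt ℝ 2 f xs)
    (hg : ∀ k, ContDiffAt ℝ 2 (g k) xs) (hxs : IsSolution f g xs)
    (hS : SurjectiveDerivOn g xs {k | g k xs = 0}) : LocallyQuadraticDual f g := by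
  intro ls hls
  set S : Set (Fin m) := {k | g k xs = 0}
  obtain ⟨y, κ, hy, hκ, hdescent⟩ := hS.exists_lagrangian_descent hf hg ‖ls‖
  obtain ⟨δ, hδ, hslack⟩ :=
    exists_eventually_inactive_le_neg (fun k => (hg k).continuousAt) hxs.1
  have hsub : Tendsto (fun l => l - ls) (𝓝 ls) (𝓝 0) := by
    simpa using (continuous_sub_right ls).tendsto ls
  have hpair : Tendsto (fun l => (xs, coordRestrict S (l - ls))) (𝓝 ls) (𝓝 (xs, 0)) :=
    tendsto_const_nhds.prodMk_nhds <| squeeze_zero_norm (fun l => norm_coordRestrict_le (l - ls)) <|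
      by simpa using hsub.norm
  have hev : ∀ᶠ l in 𝓝 ls, l ∈ orthant m →
      dual f g l + min κ δ * ‖l - ls‖ ^ 2 ≤ dual f g ls := by
    filter_upwards [hpair.eventually hdescent, (hy.comp hpair).eventually hslack,
      hsub.norm.eventually_le_const (by simp : ‖(0 : EuclideanSpace ℝ (Fin m))‖ < 1)]
      with l hlag hneg hl₁ hl
    exact hls.dual_add_le hD hxs hl hl₁ hδ.le hneg
      (hlag (coordRestrict_mem_supportedOn _) ls le_rfl (hls.isMinOn hxs))
  obtain ⟨D, hD₀, hball⟩ := Metric.nhds_basis_closedBall.eventually_iff.1 hev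
  exact ⟨D, min κ δ, hD₀, lt_min hκ hδ, fun l hl hdist =>
    hball (mem_closedBall_iff_norm.2 hdist) hl⟩

lemma tendsto_argminLagrangian (hP : StronglyConvexProgram f g α β)
    (hg : ∀ k, ConvexOn ℝ Set.univ (g k)) {ls : EuclideanSpace ℝ (Fin m)} (hls : ls ∈ orthant m)
    (hxs : IsMinOn (lagrangian f g ls) Set.univ xs) :
    Tendsto (argminLagrangian f g) (𝓝[orthant m] ls) (𝓝 xs) := by
  have hnorm : Tendsto (fun l => √m * β / α * ‖l - ls‖) (𝓝[orthant m] ls) (𝓝 0) := by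
    have : Continuous fun l => √m * β / α * ‖l - ls‖ := by fun_prop
    simpa using (this.tendsto ls).mono_left nhdsWithin_le_nhds
  refine tendsto_iff_norm_sub_tendsto_zero.2 (squeeze_zero' (by simp) ?_ hnorm)
  filter_upwards [self_mem_nhdsWithin] with l hl
  exact norm_sub_le_of_isMinOn_lagrangian hP hg hls hl hxs
    (isMinOn_argminLagrangian hP.1 hP.2.1 hg hl)

lemma dual_le_add_inner_sub (hD : DualWellDefined f g) {l l' : EuclideanSpace ℝ (Fin m)}
    (hl' : l' ∈ orthant m) (hx : IsMinOn (lagrangian f g l) Set.univ x)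
    {y : EuclideanSpace ℝ (Fin n)} {κ : ℝ}
    (hdescent : lagrangian f g l' y ≤ lagrangian f g l' x - κ * ‖l' - l‖ ^ 2) :
    dual f g l' ≤ dual f g l + inner ℝ (l' - l) (constraintVec g x) - κ * ‖l' - l‖ ^ 2 := by
  rw [lagrangian_eq_lagrangian_add_inner l l' x, ← dual_eq_lagrangian hx] at hdescent
  exact (dual_le_lagrangian hD hl' y).trans hdescent

lemma exists_eventually_dual_le_add_inner_sub (hP : StronglyConvexProgram f g α β)
    (hgc : ∀ k, ConvexOn ℝ Set.univ (g k)) (hf : ContDiffAt ℝ 2 f xs)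
    (hg : ∀ k, ContDiffAt ℝ 2 (g k) xs) (hS : SurjectiveDerivOn g xs Set.univ)
    {ls : EuclideanSpace ℝ (Fin m)} (hls : ls ∈ orthant m)
    (hxs : IsMinOn (lagrangian f g ls) Set.univ xs) :
    ∃ κ : ℝ, 0 < κ ∧ ∀ᶠ p in 𝓝[orthant m] ls ×ˢ 𝓝[orthant m] ls, dual f g p.2 ≤ dual f g p.1 +
      inner ℝ (p.2 - p.1) (constraintVec g (argminLagrangian f g p.1)) - κ * ‖p.2 - p.1‖ ^ 2 := by
  obtain ⟨y, κ, -, hκ, hdescent⟩ := hS.exists_lagrangian_descent hf hg (‖ls‖ + 1)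
  have hargmin := tendsto_argminLagrangian hP hgc hls hxs
  have hpair : Tendsto (fun p : EuclideanSpace ℝ (Fin m) × EuclideanSpace ℝ (Fin m) =>
      (argminLagrangian f g p.1, p.2 - p.1)) (𝓝[orthant m] ls ×ˢ 𝓝[orthant m] ls)
      (𝓝 (xs, 0)) := by
    have hid : Tendsto id (𝓝[orthant m] ls) (𝓝 ls) := tendsto_id'.2 nhdsWithin_le_nhds
    simpa using (hargmin.comp tendsto_fst).prodMk_nhds
      ((hid.comp tendsto_snd).sub (hid.comp tendsto_fst))
  have hbdd : ∀ᶠ ν in 𝓝[orthant m] ls, ν ∈ orthant m ∧ ‖ν‖ ≤ ‖ls‖ + 1 :=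
    eventually_mem_nhdsWithin.and <| nhdsWithin_le_nhds <|
      (continuous_norm.tendsto ls).eventually_le_const (lt_add_one _)
  refine ⟨κ, hκ, ?_⟩
  filter_upwards [hpair.eventually hdescent, tendsto_fst.eventually hbdd,
    tendsto_snd.eventually hbdd] with p hp hν hl
  have hmin := isMinOn_argminLagrangian hP.1 hP.2.1 hgc hν.1
  have hlag := hp (fun k hk => absurd (Set.mem_univ k) hk) p.1 hν.2 hmin
  rw [add_sub_cancel] at hlag
  exact dual_le_add_inner_sub (dualWellDefined hP.1 hP.2.1 hgc) hl.1 hmin hlag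

lemma locallyStronglyConcaveDual (hP : StronglyConvexProgram f g α β)
    (hgc : ∀ k, ConvexOn ℝ Set.univ (g k)) (hf : ContDiffAt ℝ 2 f xs)
    (hg : ∀ k, ContDiffAt ℝ 2 (g k) xs) (hxs : IsSolution f g xs)
    (hS : SurjectiveDerivOn g xs Set.univ) : LocallyStronglyConcaveDual f g := by
  intro ls hls
  obtain ⟨κ, hκ, hsuper⟩ :=
    exists_eventually_dual_le_add_inner_sub hP hgc hf hg hS hls.1 (hls.isMinOn hxs)
  obtain ⟨t, ht, hsuper_t⟩ := eventually_prod_self_iff'.1 hsuper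
  obtain ⟨D, hD₀, hDt⟩ := (nhdsWithin_hasBasis Metric.nhds_basis_closedBall _).mem_iff.1 ht
  have hset : {l | l ∈ orthant m ∧ ‖l - ls‖ ≤ D} = Metric.closedBall ls D ∩ orthant m := by
    ext l
    exact and_comm.trans (and_congr_left' mem_closedBall_iff_norm.symm)
  refine ⟨D, 2 * κ, hD₀, by positivity, ?_⟩
  rw [hset]
  refine strongConcaveOn_of_forall_exists ((convex_closedBall ls D).inter convex_orthant)
    fun ν hν => ⟨(innerₗ _ (constraintVec g (argminLagrangian f g ν))), fun l hl => ?_⟩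
  rw [innerₗ_apply_apply, real_inner_comm, mul_div_cancel_left₀ κ two_ne_zero]
  exact hsuper_t _ (hDt hν) _ (hDt hl)

end DualCurvature

section ProjectedAscent

variable {F : Type*} [NormedAddCommGroup F] [InnerProductSpace ℝ F] {q : F → ℝ} {K s : Set F}
  {V L D : ℝ} {l G : ℕ → F} {z : F}

/-- Projected supergradient ascent on `q` over `K` with step size `1/V`. The projection step is
encoded by its variational inequality, and the choice of step size by the quadratic lower bound
`ascent` along the step. -/
structure IsProjectedAscent (q : F → ℝ) (K : Set F) (V : ℝ) (l G : ℕ → F) : Prop where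
  mem : ∀ t, l t ∈ K
  supergradient : ∀ t, ∀ z ∈ K, q z ≤ q (l t) + inner ℝ (z - l t) (G t)
  ascent : ∀ t, q (l t) + inner ℝ (l (t + 1) - l t) (G t) - V / 2 * ‖l (t + 1) - l t‖ ^ 2 ≤
    q (l (t + 1))
  projection : ∀ t, ∀ z ∈ K, inner ℝ (z - l (t + 1)) (G t - V • (l (t + 1) - l t)) ≤ 0

namespace IsProjectedAscent

lemma three_point (h : IsProjectedAscent q K V l G) (hz : z ∈ K) (t : ℕ) :
    q (l t) + inner ℝ (z - l t) (G t) - V / 2 * ‖l t - z‖ ^ 2 + V / 2 * ‖l (t + 1) - z‖ ^ 2 ≤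
      q (l (t + 1)) := by
  have hproj := h.projection t z hz
  rw [inner_sub_right, real_inner_smul_right] at hproj
  have hinner : inner ℝ (z - l t) (G t) =
      inner ℝ (z - l (t + 1)) (G t) + inner ℝ (l (t + 1) - l t) (G t) := by
    rw [← inner_add_left, sub_add_sub_cancel]
  have hnorm : ‖l t - z‖ ^ 2 = ‖z - l (t + 1)‖ ^ 2 +
      2 * inner ℝ (z - l (t + 1)) (l (t + 1) - l t) + ‖l (t + 1) - l t‖ ^ 2 := by
    rw [← norm_add_sq_real, sub_add_sub_cancel, norm_sub_rev]
  rw [hnorm, hinner, norm_sub_rev (l (t + 1)) z]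
  linarith [h.ascent t]

lemma gap_succ_le (h : IsProjectedAscent q K V l G) (hz : z ∈ K) (t : ℕ) :
    q z - q (l (t + 1)) ≤ V / 2 * (‖l t - z‖ ^ 2 - ‖l (t + 1) - z‖ ^ 2) := by
  linarith [h.three_point hz t, h.supergradient t z hz]

lemma le_succ (h : IsProjectedAscent q K V l G) (hV : 0 ≤ V) (t : ℕ) :
    q (l t) ≤ q (l (t + 1)) := by
  have hgap := h.gap_succ_le (h.mem t) t
  rw [sub_self, norm_zero, zero_pow two_ne_zero, zero_sub] at hgap
  nlinarith [sq_nonneg ‖l (t + 1) - l t‖]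

lemma mul_gap_le (h : IsProjectedAscent q K V l G) (hV : 0 ≤ V) (hz : z ∈ K) (t : ℕ) :
    t * (q z - q (l t)) ≤ V / 2 * (‖l 0 - z‖ ^ 2 - ‖l t - z‖ ^ 2) := by
  induction t with
  | zero => simp
  | succ t ih =>
    have hmono := mul_le_mul_of_nonneg_left (h.le_succ hV t) (Nat.cast_nonneg (α := ℝ) t)
    push_cast
    linarith [h.gap_succ_le hz t]

lemma antitone_norm_sub (h : IsProjectedAscent q K V l G) (hV : 0 < V) (hz : z ∈ K)
    (hmax : IsMaxOn q K z) : Antitone fun t => ‖l t - z‖ := by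
  refine antitone_nat_of_succ_le fun t => le_of_sq_le_sq ?_ (norm_nonneg _)
  have hgap := (sub_nonneg.2 (hmax (h.mem (t + 1)))).trans (h.gap_succ_le hz t)
  exact sub_nonneg.1 (nonneg_of_mul_nonneg_right hgap (half_pos hV))

end IsProjectedAscent

lemma norm_sub_le_of_gap_lt (hq : ConcaveOn ℝ K q) (hD : 0 < D) (hL : 0 < L) (hz : z ∈ K)
    (hdecay : ∀ w ∈ K, ‖w - z‖ ≤ D → q w + L * ‖w - z‖ ^ 2 ≤ q z) {w : F} (hw : w ∈ K)
    (hgap : q z - q w < L * D ^ 2) : ‖w - z‖ ≤ D := by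
  by_contra! hlt
  have hpos : 0 < ‖w - z‖ := hD.trans hlt
  set θ := D / ‖w - z‖ with hθ
  have hθ₀ : 0 < θ := by positivity
  have hθ₁ : θ ≤ 1 := (div_le_one hpos).2 hlt.le
  have hnorm : ‖(1 - θ) • z + θ • w - z‖ = D := by
    rw [show (1 - θ) • z + θ • w - z = θ • (w - z) by module, norm_smul,
      Real.norm_of_nonneg hθ₀.le, hθ, div_mul_cancel₀ _ hpos.ne']
  have hconc := hq.2 hz hw (sub_nonneg.2 hθ₁) hθ₀.le (by ring)
  have hboundary := hdecay _ (hq.1 hz hw (sub_nonneg.2 hθ₁) hθ₀.le (by ring)) hnorm.le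
  rw [hnorm] at hboundary
  simp only [smul_eq_mul] at hconc
  have hθgap : θ * (q z - q w) < L * D ^ 2 :=
    (mul_lt_mul_of_pos_left hgap hθ₀).trans_le (mul_le_of_le_one_left (by positivity) hθ₁)
  linarith

namespace IsProjectedAscent

lemma norm_sub_le_of_lt_mul (h : IsProjectedAscent q K V l G) (hV : 0 ≤ V)
    (hq : ConcaveOn ℝ K q) (hD : 0 < D) (hL : 0 < L) (hz : z ∈ K)
    (hdecay : ∀ w ∈ K, ‖w - z‖ ≤ D → q w + L * ‖w - z‖ ^ 2 ≤ q z) {t : ℕ}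
    (ht : V / 2 * ‖l 0 - z‖ ^ 2 < t * (L * D ^ 2)) : ‖l t - z‖ ≤ D := by
  refine norm_sub_le_of_gap_lt hq hD hL hz hdecay (h.mem t) ?_
  have hVt : 0 ≤ V / 2 * ‖l t - z‖ ^ 2 := by positivity
  refine lt_of_mul_lt_mul_left ?_ (Nat.cast_nonneg (α := ℝ) t)
  linarith [h.mul_gap_le hV hz t]

lemma mul_norm_sub_sq_le (h : IsProjectedAscent q K V l G) (hV : 0 ≤ V) (hz : z ∈ K)
    {t : ℕ} (ht : q (l t) + L * ‖l t - z‖ ^ 2 ≤ q z) :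
    t * (L * ‖l t - z‖ ^ 2) ≤ V / 2 * ‖l 0 - z‖ ^ 2 := by
  have hgap := mul_le_mul_of_nonneg_left (le_sub_iff_add_le'.2 ht) (Nat.cast_nonneg (α := ℝ) t)
  have hVt : 0 ≤ V / 2 * ‖l t - z‖ ^ 2 := by positivity
  linarith [h.mul_gap_le hV hz t]

lemma norm_sub_sq_succ_le (h : IsProjectedAscent q K V l G) (hV : 0 < V)
    (hmax : IsMaxOn q K z) (hq : StrongConcaveOn s L q) (hs : s ⊆ K) (hzs : z ∈ s) {t : ℕ}
    (ht : l t ∈ s) : ‖l (t + 1) - z‖ ^ 2 ≤ (1 - L / V) * ‖l t - z‖ ^ 2 := by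
  have hsuper := le_add_sub_sq_of_forall_le_add hq ht hzs (φ := (innerₗ F) (G t)) fun w hw => by
    rw [innerₗ_apply_apply, real_inner_comm]
    exact h.supergradient t w (hs hw)
  rw [innerₗ_apply_apply, real_inner_comm, norm_sub_rev] at hsuper
  refine le_of_mul_le_mul_left ?_ (half_pos hV)
  calc V / 2 * ‖l (t + 1) - z‖ ^ 2 ≤ V / 2 * ‖l t - z‖ ^ 2 - L / 2 * ‖l t - z‖ ^ 2 := by
        have hle : q (l (t + 1)) ≤ q z := hmax (h.mem (t + 1))
        linarith [h.three_point (hs hzs) t]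
    _ = V / 2 * ((1 - L / V) * ‖l t - z‖ ^ 2) := by field_simp

lemma norm_sub_sq_le_pow_mul (h : IsProjectedAscent q K V l G) (hV : 0 < V) (hLV : L ≤ V)
    (hmax : IsMaxOn q K z) (hq : StrongConcaveOn s L q) (hs : s ⊆ K) (hzs : z ∈ s) {T : ℕ}
    (hT : ∀ t, T ≤ t → l t ∈ s) (j : ℕ) :
    ‖l (T + j) - z‖ ^ 2 ≤ (1 - L / V) ^ j * ‖l T - z‖ ^ 2 :=
  le_geom (u := fun j => ‖l (T + j) - z‖ ^ 2) (sub_nonneg.2 ((div_le_one hV).2 hLV)) j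
    fun i _ => h.norm_sub_sq_succ_le hV hmax hq hs hzs (hT _ (Nat.le_add_right T i))

end IsProjectedAscent

end ProjectedAscent

section Algorithm

variable {n m : ℕ} {f : EuclideanSpace ℝ (Fin n) → ℝ}
  {g : Fin m → EuclideanSpace ℝ (Fin n) → ℝ} {xs y : EuclideanSpace ℝ (Fin n)} {α β V : ℝ}
  {Q0 q : EuclideanSpace ℝ (Fin m)} {x : ℕ → EuclideanSpace ℝ (Fin n)}
  {Q : ℕ → EuclideanSpace ℝ (Fin m)} {xbar : ℕ → EuclideanSpace ℝ (Fin n)}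
  {ls : EuclideanSpace ℝ (Fin m)} {D L : ℝ}

lemma smul_mem_orthant {c : ℝ} (hc : 0 ≤ c) (hq : q ∈ orthant m) : c • q ∈ orthant m :=
  fun k => mul_nonneg hc (hq k)

lemma mul_lagrangian_inv_smul (hV : V ≠ 0) (q : EuclideanSpace ℝ (Fin m))
    (y : EuclideanSpace ℝ (Fin n)) :
    V * lagrangian f g (V⁻¹ • q) y = V * f y + ∑ k, q k * g k y := by
  simp only [lagrangian, mul_add, Finset.mul_sum, PiLp.smul_apply, smul_eq_mul, mul_assoc,
    mul_inv_cancel_left₀ hV]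

lemma isMinOn_lagrangian_inv_smul_iff (hV : 0 < V) :
    IsMinOn (lagrangian f g (V⁻¹ • q)) Set.univ y ↔
      IsMinOn (fun y => V * f y + ∑ k, q k * g k y) Set.univ y := by
  simp only [isMinOn_iff, ← mul_lagrangian_inv_smul hV.ne', mul_le_mul_iff_right₀ hV]

lemma exists_isShiftedRun (hα : 0 < α) (hf : StrongConvexOn Set.univ α f)
    (hg : ∀ k, ConvexOn ℝ Set.univ (g k)) (hV : 0 < V) (hQ0 : Q0 ∈ orthant m) :
    ∃ x Q xbar, IsShiftedRun f g V Q0 x Q xbar := by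
  let X : EuclideanSpace ℝ (Fin m) → EuclideanSpace ℝ (Fin n) :=
    fun q => argminLagrangian f g (V⁻¹ • q)
  let Q : ℕ → EuclideanSpace ℝ (Fin m) := fun t =>
    Nat.rec Q0 (fun _ q => WithLp.toLp 2 fun k => max (q k + g k (X q)) 0) t
  have hQ : ∀ t, Q t ∈ orthant m
    | 0 => hQ0
    | t + 1 => fun k => le_max_right _ _
  refine ⟨fun t => X (Q t), Q,
    fun t => (((t / 2 * 2 : ℕ) : ℝ) / 2)⁻¹ • ∑ τ ∈ Finset.Ico (t / 2) (t / 2 * 2), X (Q τ),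
    rfl, fun t => ?_, fun t k => rfl, fun t ht => ?_, fun t ht => ?_⟩
  · exact (isMinOn_lagrangian_inv_smul_iff hV).1 <|
      isMinOn_argminLagrangian hα hf hg (smul_mem_orthant (inv_nonneg.2 hV.le) (hQ t))
  · rw [Nat.div_two_mul_two_of_even ht]
  · rw [show (t + 1) / 2 = t / 2 by grind]

namespace IsShiftedRun

lemma queue_mem_orthant (hrun : IsShiftedRun f g V Q0 x Q xbar) (hQ0 : Q0 ∈ orthant m) (t : ℕ) :
    Q t ∈ orthant m := by
  cases t with
  | zero => exact hrun.init ▸ hQ0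
  | succ t => exact fun k => hrun.queue t k ▸ le_max_right _ _

lemma inv_smul_queue_mem_orthant (hrun : IsShiftedRun f g V Q0 x Q xbar) (hV : 0 ≤ V)
    (hQ0 : Q0 ∈ orthant m) (t : ℕ) : V⁻¹ • Q t ∈ orthant m :=
  smul_mem_orthant (inv_nonneg.2 hV) (hrun.queue_mem_orthant hQ0 t)

lemma isMinOn_lagrangian (hrun : IsShiftedRun f g V Q0 x Q xbar) (hV : 0 < V) (t : ℕ) :
    IsMinOn (lagrangian f g (V⁻¹ • Q t)) Set.univ (x t) :=
  (isMinOn_lagrangian_inv_smul_iff hV).2 (hrun.argmin t)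

lemma xbar_two_mul (hrun : IsShiftedRun f g V Q0 x Q xbar) {s : ℕ} (hs : 1 ≤ s) :
    xbar (2 * s) = (s : ℝ)⁻¹ • ∑ τ ∈ Finset.Ico s (2 * s), x τ := by
  have havg := hrun.avg_even (2 * s - 1)
  rw [Nat.sub_add_cancel (by omega), Nat.mul_div_cancel_left s two_pos] at havg
  rw [havg (even_two_mul s), Nat.cast_mul, Nat.cast_ofNat, mul_div_cancel_left₀ _ two_ne_zero]

lemma xbar_eq (hrun : IsShiftedRun f g V Q0 x Q xbar) {t : ℕ} (ht : 2 ≤ t) :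
    xbar t = ((t / 2 : ℕ) : ℝ)⁻¹ • ∑ τ ∈ Finset.Ico (t / 2) (2 * (t / 2)), x τ := by
  rw [← hrun.xbar_two_mul (by omega)]
  rcases Nat.even_or_odd' t with ⟨s, rfl | rfl⟩
  · rw [Nat.mul_div_cancel_left s two_pos]
  · rw [hrun.avg_odd (2 * s) (odd_two_mul_add_one s), show (2 * s + 1) / 2 = s by omega]

end IsShiftedRun

lemma sub_mul_sub_max_zero_nonpos {z : ℝ} (hz : 0 ≤ z) (c a : ℝ) :
    (z - c * max a 0) * (a - max a 0) ≤ 0 := by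
  rcases le_total 0 a with ha | ha
  · simp [max_eq_left ha]
  · simpa [max_eq_right ha] using mul_nonpos_of_nonneg_of_nonpos hz ha

lemma IsShiftedRun.isProjectedAscent (hrun : IsShiftedRun f g V Q0 x Q xbar)
    (hP : StronglyConvexProgram f g α β) (hg : ∀ k, ConvexOn ℝ Set.univ (g k)) (hV : 0 < V)
    (hVβ : m * β ^ 2 / α ≤ V) (hQ0 : Q0 ∈ orthant m) :
    IsProjectedAscent (dual f g) (orthant m) V (fun t => V⁻¹ • Q t)
      (fun t => constraintVec g (x t)) where
  mem := hrun.inv_smul_queue_mem_orthant hV.le hQ0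
  supergradient t z hz :=
    dual_le_add_inner (dualWellDefined hP.1 hP.2.1 hg) hz (hrun.isMinOn_lagrangian hV t)
  ascent t := dual_add_inner_sub_sq_le_dual hP hg hVβ (hrun.inv_smul_queue_mem_orthant hV.le hQ0 t)
    (hrun.inv_smul_queue_mem_orthant hV.le hQ0 (t + 1)) (hrun.isMinOn_lagrangian hV t)
  projection t z hz := by
    rw [← smul_sub, smul_inv_smul₀ hV.ne', inner_eq_sum]
    refine Finset.sum_nonpos fun k _ => ?_
    have hcoord := sub_mul_sub_max_zero_nonpos (hz k) V⁻¹ (Q t k + g k (x t))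
    rw [← hrun.queue t k] at hcoord
    simp only [PiLp.sub_apply, PiLp.smul_apply, smul_eq_mul, constraintVec_apply]
    linarith

lemma max_zero_sq_sub_sq_le {a b c : ℝ} (hc : c ≤ 0) :
    max (a + b) 0 ^ 2 / 2 - a ^ 2 / 2 ≤ a * b - a * c + (c - b) ^ 2 / 2 := by
  rcases le_total 0 (a + b) with h | h
  · rw [max_eq_left h]
    linarith [mul_nonpos_of_nonneg_of_nonpos h hc, sq_nonneg c]
  · rw [max_eq_right h]
    linarith [sq_nonneg (a + b - c)]

lemma norm_sq_constraintVec_sub_le (hP : StronglyConvexProgram f g α β)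
    (hVβ : m * β ^ 2 / α ≤ V) (x y : EuclideanSpace ℝ (Fin n)) :
    ‖constraintVec g y - constraintVec g x‖ ^ 2 ≤ V * α * ‖y - x‖ ^ 2 := by
  calc ‖constraintVec g y - constraintVec g x‖ ^ 2 ≤ (√m * β * ‖y - x‖) ^ 2 := by
        gcongr
        exact norm_constraintVec_sub_le hP.2.2.1.le hP.2.2.2 x y
    _ = m * β ^ 2 * ‖y - x‖ ^ 2 := by
        rw [mul_pow, mul_pow, Real.sq_sqrt (Nat.cast_nonneg m)]
    _ ≤ V * α * ‖y - x‖ ^ 2 := by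
        exact mul_le_mul_of_nonneg_right ((div_le_iff₀ hP.1).1 hVβ) (sq_nonneg _)

lemma map_average_Ico_le {E : Type*} [AddCommGroup E] [Module ℝ E] {h : E → ℝ}
    (hh : ConvexOn ℝ Set.univ h) {s t : ℕ} (hst : s < t) (y : ℕ → E) :
    h (((t - s : ℕ) : ℝ)⁻¹ • ∑ τ ∈ Finset.Ico s t, y τ) ≤
      (∑ τ ∈ Finset.Ico s t, h (y τ)) / (t - s : ℕ) := by
  have hpos : (0 : ℝ) < (t - s : ℕ) := Nat.cast_pos.2 (Nat.sub_pos_of_lt hst)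
  rw [Finset.smul_sum, div_eq_inv_mul, Finset.mul_sum]
  refine hh.map_sum_le (fun _ _ => by positivity) ?_ (fun _ _ => Set.mem_univ _)
  rw [Finset.sum_const, Nat.card_Ico, nsmul_eq_mul, mul_inv_cancel₀ hpos.ne']

namespace IsShiftedRun

lemma norm_sq_queue_succ_sub_le (hrun : IsShiftedRun f g V Q0 x Q xbar) (hy : y ∈ feasible g)
    (t : ℕ) :
    ‖Q (t + 1)‖ ^ 2 / 2 - ‖Q t‖ ^ 2 / 2 ≤ ∑ k, Q t k * g k (x t) - ∑ k, Q t k * g k y +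
      ‖constraintVec g y - constraintVec g (x t)‖ ^ 2 / 2 := by
  simp only [EuclideanSpace.real_norm_sq_eq, Finset.sum_div, ← Finset.sum_sub_distrib,
    ← Finset.sum_add_distrib, PiLp.sub_apply, constraintVec_apply, hrun.queue]
  exact Finset.sum_le_sum fun k _ => max_zero_sq_sub_sq_le (hy k)

lemma drift_add_penalty_le (hrun : IsShiftedRun f g V Q0 x Q xbar)
    (hP : StronglyConvexProgram f g α β) (hg : ∀ k, ConvexOn ℝ Set.univ (g k)) (hV : 0 < V)
    (hVβ : m * β ^ 2 / α ≤ V) (hQ0 : Q0 ∈ orthant m) (hy : y ∈ feasible g) (t : ℕ) :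
    ‖Q (t + 1)‖ ^ 2 / 2 - ‖Q t‖ ^ 2 / 2 + V * f (x t) ≤ V * f y := by
  have hconvex := mul_le_mul_of_nonneg_left
    (add_sq_le_of_isMinOn (strongConvexOn_lagrangian hP.2.1 hg
      (hrun.inv_smul_queue_mem_orthant hV.le hQ0 t)) (Set.mem_univ _) (Set.mem_univ y)
      (hrun.isMinOn_lagrangian hV t)) hV.le
  rw [mul_add, mul_lagrangian_inv_smul hV.ne', mul_lagrangian_inv_smul hV.ne'] at hconvex
  linarith [hrun.norm_sq_queue_succ_sub_le hy t, norm_sq_constraintVec_sub_le hP hVβ (x t) y]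

lemma sum_objective_le (hrun : IsShiftedRun f g V Q0 x Q xbar)
    (hP : StronglyConvexProgram f g α β) (hg : ∀ k, ConvexOn ℝ Set.univ (g k)) (hV : 0 < V)
    (hVβ : m * β ^ 2 / α ≤ V) (hQ0 : Q0 ∈ orthant m) (hy : y ∈ feasible g) {s t : ℕ}
    (hst : s ≤ t) :
    ∑ τ ∈ Finset.Ico s t, f (x τ) ≤ (t - s : ℕ) * f y + (‖Q s‖ ^ 2 - ‖Q t‖ ^ 2) / (2 * V) := by
  calc ∑ τ ∈ Finset.Ico s t, f (x τ)
      ≤ ∑ τ ∈ Finset.Ico s t, (f y - (‖Q (τ + 1)‖ ^ 2 / (2 * V) - ‖Q τ‖ ^ 2 / (2 * V))) := by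
        refine Finset.sum_le_sum fun τ _ => ?_
        have hdrift := hrun.drift_add_penalty_le hP hg hV hVβ hQ0 hy τ
        rw [← sub_div, le_sub_iff_add_le', ← le_sub_iff_add_le, div_le_iff₀ (by positivity)]
        linarith
    _ = (t - s : ℕ) * f y + (‖Q s‖ ^ 2 - ‖Q t‖ ^ 2) / (2 * V) := by
        rw [Finset.sum_sub_distrib, Finset.sum_Ico_sub (fun τ => ‖Q τ‖ ^ 2 / (2 * V)) hst,
          Finset.sum_const, Nat.card_Ico, nsmul_eq_mul]
        ring

lemma sum_constraint_le (hrun : IsShiftedRun f g V Q0 x Q xbar) (k : Fin m) {s t : ℕ}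
    (hst : s ≤ t) : ∑ τ ∈ Finset.Ico s t, g k (x τ) ≤ (Q t - Q s) k := by
  rw [PiLp.sub_apply, ← Finset.sum_Ico_sub (fun τ => Q τ k) hst]
  refine Finset.sum_le_sum fun τ _ => ?_
  rw [hrun.queue]
  linarith [le_max_left (Q τ k + g k (x τ)) 0]

lemma objective_xbar_le (hrun : IsShiftedRun f g V Q0 x Q xbar)
    (hP : StronglyConvexProgram f g α β) (hg : ∀ k, ConvexOn ℝ Set.univ (g k)) (hV : 0 < V)
    (hVβ : m * β ^ 2 / α ≤ V) (hQ0 : Q0 ∈ orthant m) (hy : y ∈ feasible g) {t : ℕ}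
    (ht : 2 ≤ t) :
    f (xbar t) ≤
      f y + (‖Q (t / 2)‖ ^ 2 - ‖Q (2 * (t / 2))‖ ^ 2) / (2 * V) / (t / 2 : ℕ) := by
  rw [hrun.xbar_eq ht]
  generalize hs : t / 2 = s
  have hs₀ : (0 : ℝ) < s := Nat.cast_pos.2 (by omega)
  have hlen : 2 * s - s = s := by omega
  have hsum := hrun.sum_objective_le hP hg hV hVβ hQ0 hy (show s ≤ 2 * s by omega)
  have havg := map_average_Ico_le (strongConvexOn_zero.1 (hP.2.1.mono hP.1.le))
    (show s < 2 * s by omega) x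
  rw [hlen] at hsum havg
  refine havg.trans ?_
  rw [div_le_iff₀ hs₀, add_mul, div_mul_cancel₀ _ hs₀.ne']
  linarith

lemma constraint_xbar_le (hrun : IsShiftedRun f g V Q0 x Q xbar) {k : Fin m}
    (hg : ConvexOn ℝ Set.univ (g k)) {t : ℕ} (ht : 2 ≤ t) :
    g k (xbar t) ≤ (Q (2 * (t / 2)) - Q (t / 2)) k / (t / 2 : ℕ) := by
  rw [hrun.xbar_eq ht]
  generalize hs : t / 2 = s
  have havg := map_average_Ico_le hg (show s < 2 * s by omega) x
  rw [show 2 * s - s = s by omega] at havg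
  refine havg.trans ?_
  gcongr
  exact hrun.sum_constraint_le k (by omega)

end IsShiftedRun

lemma norm_sub_le_two_mul_of_antitone {E : Type*} [SeminormedAddCommGroup E] {u : ℕ → E} {z : E}
    (hu : Antitone fun t => ‖u t - z‖) {s t : ℕ} (hst : s ≤ t) :
    ‖u t - u s‖ ≤ 2 * ‖u s - z‖ := by
  have htri := norm_sub_le_norm_sub_add_norm_sub (u t) z (u s)
  rw [norm_sub_rev z] at htri
  linarith [hu hst]

lemma sq_sub_sq_le_of_antitone {E : Type*} [SeminormedAddCommGroup E] {u : ℕ → E} {z : E}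
    (hu : Antitone fun t => ‖u t - z‖) {s t : ℕ} (hst : s ≤ t) :
    ‖u s‖ ^ 2 - ‖u t‖ ^ 2 ≤ 4 * (‖z‖ + ‖u 0 - z‖) * ‖u s - z‖ := by
  have hbound : ∀ τ, ‖u τ‖ ≤ ‖z‖ + ‖u 0 - z‖ := fun τ =>
    (norm_le_norm_add_norm_sub' (u τ) z).trans (by gcongr; exact hu (Nat.zero_le τ))
  have hdiff : ‖u s‖ - ‖u t‖ ≤ 2 * ‖u s - z‖ :=
    (norm_sub_norm_le _ _).trans (norm_sub_rev (u s) (u t) ▸ norm_sub_le_two_mul_of_antitone hu hst)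
  calc ‖u s‖ ^ 2 - ‖u t‖ ^ 2 = (‖u s‖ + ‖u t‖) * (‖u s‖ - ‖u t‖) := sq_sub_sq _ _
    _ ≤ (‖u s‖ + ‖u t‖) * (2 * ‖u s - z‖) := by gcongr
    _ ≤ (‖z‖ + ‖u 0 - z‖ + (‖z‖ + ‖u 0 - z‖)) * (2 * ‖u s - z‖) := by
        gcongr <;> exact hbound _
    _ = 4 * (‖z‖ + ‖u 0 - z‖) * ‖u s - z‖ := by ring

lemma IsEpsOptimal.mono {ε ε' : ℝ} (h : IsEpsOptimal f g xs ε y) (hε : ε ≤ ε') :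
    IsEpsOptimal f g xs ε' y :=
  ⟨h.1.trans (by gcongr), fun k => (h.2 k).trans hε⟩

lemma IsShiftedRun.isEpsOptimal_xbar (hrun : IsShiftedRun f g V Q0 x Q xbar)
    (hP : StronglyConvexProgram f g α β) (hg : ∀ k, ConvexOn ℝ Set.univ (g k)) (hV : 0 < V)
    (hVβ : m * β ^ 2 / α ≤ V) (hQ0 : Q0 ∈ orthant m) (hxs : IsSolution f g xs)
    (hls : IsLagrangeMultiplier f g ls) {t : ℕ} (ht : 2 ≤ t) :
    IsEpsOptimal f g xs
      (2 * V * (‖ls‖ + ‖V⁻¹ • Q0 - ls‖ + 1) * (‖V⁻¹ • Q (t / 2) - ls‖ / (t / 2 : ℕ)))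
      (xbar t) := by
  have hmono : Antitone fun t => ‖V⁻¹ • Q t - ls‖ :=
    (hrun.isProjectedAscent hP hg hV hVβ hQ0).antitone_norm_sub hV hls.1
      (hls.isMaxOn (dualWellDefined hP.1 hP.2.1 hg))
  have hwindow : t / 2 ≤ 2 * (t / 2) := Nat.le_mul_of_pos_left _ two_pos
  rw [← mul_div_assoc]
  refine ⟨(hrun.objective_xbar_le hP hg hV hVβ hQ0 hxs.1 ht).trans ?_, fun k =>
    (hrun.constraint_xbar_le (hg k) ht).trans ?_⟩
  · gcongr
    have hsq := sq_sub_sq_le_of_antitone hmono hwindow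
    simp only [norm_smul, norm_inv, Real.norm_of_nonneg hV.le, mul_pow, inv_pow, hrun.init,
      ← mul_sub, inv_mul_le_iff₀ (pow_pos hV 2)] at hsq
    rw [div_le_iff₀ (by positivity)]
    have hρ : 0 ≤ V ^ 2 * ‖V⁻¹ • Q (t / 2) - ls‖ := by positivity
    linarith
  · gcongr
    have hdiff := norm_sub_le_two_mul_of_antitone hmono hwindow
    rw [← smul_sub, norm_smul, norm_inv, Real.norm_of_nonneg hV.le, inv_mul_le_iff₀ hV] at hdiff
    have hρ : 0 ≤ (‖ls‖ + ‖V⁻¹ • Q0 - ls‖) * (V * ‖V⁻¹ • Q (t / 2) - ls‖) := by positivity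
    linarith [(le_abs_self _).trans (PiLp.norm_apply_le (Q (2 * (t / 2)) - Q (t / 2)) k)]

lemma exists_forall_norm_sub_le (hP : StronglyConvexProgram f g α β)
    (hg : ∀ k, ConvexOn ℝ Set.univ (g k)) (hV : 0 < V) (hVβ : m * β ^ 2 / α ≤ V)
    (hQ0 : Q0 ∈ orthant m) (hls : IsLagrangeMultiplier f g ls)
    (hq : IsLocallyQuadraticAt f g ls D L) :
    ∃ T : ℕ, ∀ x Q xbar, IsShiftedRun f g V Q0 x Q xbar → ∀ t, T ≤ t →
      ‖V⁻¹ • Q t - ls‖ ≤ D := by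
  obtain ⟨hD, hL, hdecay⟩ := hq
  have hLD : 0 < L * D ^ 2 := by positivity
  obtain ⟨T, hT⟩ := exists_nat_gt (V / 2 * ‖V⁻¹ • Q0 - ls‖ ^ 2 / (L * D ^ 2))
  rw [div_lt_iff₀ hLD] at hT
  refine ⟨T, fun x Q xbar hrun t ht => ?_⟩
  refine (hrun.isProjectedAscent hP hg hV hVβ hQ0).norm_sub_le_of_lt_mul hV.le
    (concaveOn_dual (dualWellDefined hP.1 hP.2.1 hg)) hD hL hls.1 hdecay ?_
  rw [hrun.init]
  exact hT.trans_le (by gcongr)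

namespace IsLocallyStronglyConcaveAt

lemma mono {L' : ℝ} (hc : IsLocallyStronglyConcaveAt f g ls D L) (hL' : 0 < L') (hle : L' ≤ L) :
    IsLocallyStronglyConcaveAt f g ls D L' :=
  ⟨hc.1, hL', hc.2.2.mono hle⟩

lemma isLocallyQuadraticAt (hc : IsLocallyStronglyConcaveAt f g ls D L) (hls : ls ∈ orthant m)
    (hmax : IsMaxOn (dual f g) (orthant m) ls) : IsLocallyQuadraticAt f g ls D (L / 2) := by
  obtain ⟨hD, hL, hconc⟩ := hc
  refine ⟨hD, half_pos hL, fun l hl hld => ?_⟩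
  have hgrowth := add_sq_le_of_isMinOn hconc.neg ⟨hls, by simpa using hD.le⟩ ⟨hl, hld⟩
    (hmax.neg.on_subset fun z hz => hz.1)
  simp only [Pi.neg_apply] at hgrowth
  linarith

end IsLocallyStronglyConcaveAt

end Algorithm

section Rates

variable {n m : ℕ} {f : EuclideanSpace ℝ (Fin n) → ℝ}
  {g : Fin m → EuclideanSpace ℝ (Fin n) → ℝ} {xs : EuclideanSpace ℝ (Fin n)} {α β V : ℝ}
  {Q0 ls : EuclideanSpace ℝ (Fin m)} {D L : ℝ} {r : ℕ → ℝ}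

lemma errorDecaysLike_of_norm_sub_le (hP : StronglyConvexProgram f g α β)
    (hg : ∀ k, ConvexOn ℝ Set.univ (g k)) (hV : 0 < V) (hVβ : m * β ^ 2 / α ≤ V)
    (hQ0 : Q0 ∈ orthant m) (hxs : IsSolution f g xs) (hls : IsLagrangeMultiplier f g ls)
    {ρ : ℕ → ℝ} {C : ℝ} {T : ℕ}
    (hρ : ∀ x Q xbar, IsShiftedRun f g V Q0 x Q xbar → ∀ t, T ≤ t → ‖V⁻¹ • Q t - ls‖ ≤ ρ t)
    (hC : 0 ≤ C) (hr : ∀ t : ℕ, 2 ≤ t → ρ (t / 2) / (t / 2 : ℕ) ≤ C * r t) :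
    ErrorDecaysLike f g xs V Q0 r := by
  refine ⟨2 * V * (‖ls‖ + ‖V⁻¹ • Q0 - ls‖ + 1) * C, by positivity, 2 * T + 2,
    fun x Q xbar hrun t ht => ?_⟩
  refine (hrun.isEpsOptimal_xbar hP hg hV hVβ hQ0 hxs hls (by omega)).mono ?_
  rw [mul_assoc _ C]
  gcongr
  refine le_trans ?_ (hr t (by omega))
  gcongr
  exact hρ x Q xbar hrun _ (by omega)

lemma div_three_le_half {t : ℕ} (ht : 2 ≤ t) : (t : ℝ) / 3 ≤ (t / 2 : ℕ) := by
  rw [div_le_iff₀ three_pos]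
  exact_mod_cast (by omega : t ≤ t / 2 * 3)

lemma one_div_sqrt_half_div_le {t : ℕ} (ht : 2 ≤ t) :
    1 / √(t / 2 : ℕ) / (t / 2 : ℕ) ≤ 3 ^ (3 / 2 : ℝ) * (1 / (t : ℝ) ^ (3 / 2 : ℝ)) := by
  have ht₀ : (0 : ℝ) < t := Nat.cast_pos.2 (by omega)
  have hs₀ : (0 : ℝ) < (t / 2 : ℕ) := Nat.cast_pos.2 (by omega)
  calc 1 / √(t / 2 : ℕ) / (t / 2 : ℕ) = 1 / ((t / 2 : ℕ) : ℝ) ^ (3 / 2 : ℝ) := by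
        rw [div_div, Real.sqrt_eq_rpow, ← Real.rpow_add_one hs₀.ne']
        norm_num
    _ ≤ 1 / ((t : ℝ) / 3) ^ (3 / 2 : ℝ) := by
        gcongr
        exact div_three_le_half ht
    _ = 3 ^ (3 / 2 : ℝ) * (1 / (t : ℝ) ^ (3 / 2 : ℝ)) := by
        rw [Real.div_rpow ht₀.le zero_le_three, one_div_div, mul_one_div]

lemma errorDecaysLike_of_isLocallyQuadraticAt (hP : StronglyConvexProgram f g α β)
    (hg : ∀ k, ConvexOn ℝ Set.univ (g k)) (hV : 0 < V) (hVβ : m * β ^ 2 / α ≤ V)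
    (hQ0 : Q0 ∈ orthant m) (hxs : IsSolution f g xs) (hls : IsLagrangeMultiplier f g ls)
    (hq : IsLocallyQuadraticAt f g ls D L) :
    ErrorDecaysLike f g xs V Q0 (fun t => 1 / (t : ℝ) ^ (3 / 2 : ℝ)) := by
  obtain ⟨T, hT⟩ := exists_forall_norm_sub_le hP hg hV hVβ hQ0 hls hq
  obtain ⟨-, hL, hdecay⟩ := hq
  set A := √(V / 2 * ‖V⁻¹ • Q0 - ls‖ ^ 2 / L) with hA
  refine errorDecaysLike_of_norm_sub_le hP hg hV hVβ hQ0 hxs hls (ρ := fun t => A * (1 / √t))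
    (C := A * 3 ^ (3 / 2 : ℝ)) (T := max T 1) (fun x Q xbar hrun t ht => ?_) (by positivity)
    fun t ht => ?_
  · have ht₀ : (0 : ℝ) < t := Nat.cast_pos.2 ((le_max_right T 1).trans ht)
    have hascent := hrun.isProjectedAscent hP hg hV hVβ hQ0
    have hsq := hascent.mul_norm_sub_sq_le hV.le hls.1 <|
      hdecay _ (hascent.mem t) (hT x Q xbar hrun t ((le_max_left T 1).trans ht))
    rw [hrun.init] at hsq
    rw [hA, mul_one_div, ← Real.sqrt_div (by positivity)]
    refine Real.le_sqrt_of_sq_le ?_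
    rw [le_div_iff₀ ht₀, le_div_iff₀ hL]
    linarith
  · rw [mul_div_assoc, mul_assoc]
    gcongr
    exact one_div_sqrt_half_div_le ht

lemma rpow_half_sub_div_half_le {θ : ℝ} (hθ₀ : 0 < θ) (hθ₁ : θ ≤ 1) (T : ℕ) {t : ℕ}
    (ht : 2 ≤ t) :
    θ ^ ((((t / 2 : ℕ) : ℝ) - T) / 2) / (t / 2 : ℕ) ≤
      θ ^ (-(1 + 2 * T : ℝ) / 4) * 3 * (1 / (t : ℝ) * θ ^ ((t : ℝ) / 4)) := by
  have : (0 : ℝ) < t := Nat.cast_pos.2 (by omega)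
  have hhalf : (t : ℝ) ≤ 2 * (t / 2 : ℕ) + 1 := by exact_mod_cast (by omega : t ≤ 2 * (t / 2) + 1)
  calc θ ^ ((((t / 2 : ℕ) : ℝ) - T) / 2) / (t / 2 : ℕ)
      ≤ θ ^ (-(1 + 2 * T : ℝ) / 4 + (t : ℝ) / 4) / ((t : ℝ) / 3) := by
        gcongr ?_ / ?_
        · exact Real.rpow_le_rpow_of_exponent_ge hθ₀ hθ₁ (by linarith)
        · exact div_three_le_half ht
    _ = θ ^ (-(1 + 2 * T : ℝ) / 4) * 3 * (1 / (t : ℝ) * θ ^ ((t : ℝ) / 4)) := by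
        rw [Real.rpow_add hθ₀]
        field_simp

lemma norm_le_of_sq_le_pow_mul {E : Type*} [NormedAddCommGroup E] {u v : E} {θ : ℝ}
    (hθ : 0 ≤ θ) {j : ℕ} (h : ‖u‖ ^ 2 ≤ θ ^ j * ‖v‖ ^ 2) :
    ‖u‖ ≤ ‖v‖ * θ ^ ((j : ℝ) / 2) := by
  refine le_of_sq_le_sq ?_ (by positivity)
  rwa [mul_pow, ← Real.rpow_mul_natCast hθ, Nat.cast_ofNat, div_mul_cancel₀ _ two_ne_zero,
    Real.rpow_natCast, mul_comm]

lemma errorDecaysLike_of_isLocallyStronglyConcaveAt (hP : StronglyConvexProgram f g α β)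
    (hg : ∀ k, ConvexOn ℝ Set.univ (g k)) (hV : 0 < V) (hVβ : m * β ^ 2 / α ≤ V)
    (hQ0 : Q0 ∈ orthant m) (hxs : IsSolution f g xs) (hls : IsLagrangeMultiplier f g ls)
    (hc : IsLocallyStronglyConcaveAt f g ls D L) :
    ErrorDecaysLike f g xs V Q0 (fun t => 1 / (t : ℝ) * (1 - L / V) ^ ((t : ℝ) / 4)) := by
  have hmax := hls.isMaxOn (dualWellDefined hP.1 hP.2.1 hg)
  obtain ⟨T, hT⟩ := exists_forall_norm_sub_le hP hg hV hVβ hQ0 hls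
    (hc.isLocallyQuadraticAt hls.1 hmax)
  obtain ⟨hD, hL, hconc⟩ := hc
  have hlsD : ls ∈ {l | l ∈ orthant m ∧ ‖l - ls‖ ≤ D} := ⟨hls.1, by simpa using hD.le⟩
  rcases le_or_gt V L with hVL | hLV
  · refine errorDecaysLike_of_norm_sub_le hP hg hV hVβ hQ0 hxs hls (ρ := 0) (C := 0) (T := T + 1)
      (fun x Q xbar hrun t ht => ?_) le_rfl (by simp)
    obtain ⟨j, rfl⟩ := Nat.exists_eq_succ_of_ne_zero (by omega : t ≠ 0)
    have hascent := hrun.isProjectedAscent hP hg hV hVβ hQ0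
    have hstep := hascent.norm_sub_sq_succ_le hV hmax hconc (fun l hl => hl.1) hlsD
      (t := j) ⟨hascent.mem j, hT x Q xbar hrun j (by omega)⟩
    refine le_of_sq_le_sq (hstep.trans ?_) le_rfl
    simpa using mul_nonpos_of_nonpos_of_nonneg (sub_nonpos.2 ((one_le_div hV).2 hVL))
      (sq_nonneg ‖V⁻¹ • Q j - ls‖)
  · have hθ₀ : 0 < 1 - L / V := sub_pos.2 ((div_lt_one hV).2 hLV)
    have hθ₁ : 1 - L / V ≤ 1 := sub_le_self _ (by positivity)
    refine errorDecaysLike_of_norm_sub_le hP hg hV hVβ hQ0 hxs hls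
      (ρ := fun t => ‖V⁻¹ • Q0 - ls‖ * (1 - L / V) ^ (((t : ℝ) - T) / 2))
      (C := ‖V⁻¹ • Q0 - ls‖ * ((1 - L / V) ^ (-(1 + 2 * T : ℝ) / 4) * 3)) (T := T)
      (fun x Q xbar hrun t ht => ?_) (by positivity) fun t ht => ?_
    · obtain ⟨j, rfl⟩ := Nat.exists_eq_add_of_le ht
      have hascent := hrun.isProjectedAscent hP hg hV hVβ hQ0
      have hgeom := norm_le_of_sq_le_pow_mul hθ₀.le <|
        hascent.norm_sub_sq_le_pow_mul hV hLV.le hmax hconc (fun l hl => hl.1) hlsD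
          (fun t ht => ⟨hascent.mem t, hT x Q xbar hrun t ht⟩) j
      rw [Nat.cast_add, add_sub_cancel_left, ← hrun.init]
      exact hgeom.trans (by gcongr; exact hascent.antitone_norm_sub hV hls.1 hmax (Nat.zero_le T))
    · rw [mul_div_assoc, mul_assoc]
      gcongr
      exact rpow_half_sub_div_half_le hθ₀ hθ₁ T ht

lemma hasConvergenceTime_of_errorDecaysLike {h : ℝ → ℝ} (hh : Tendsto h (𝓝[>] 0) atTop)
    (hdec : ErrorDecaysLike f g xs V Q0 r)
    (hr : ∀ C : ℝ, 0 ≤ C → ∃ C' : ℝ, 0 < C' ∧ ∀ᶠ ε in 𝓝[>] (0 : ℝ), ∀ t : ℕ, 1 ≤ t →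
      C' * h ε ≤ t → C * r t ≤ ε) :
    HasConvergenceTime f g xs V Q0 h := by
  obtain ⟨C, hC, T, hT⟩ := hdec
  obtain ⟨C', hC', hev⟩ := hr C hC
  refine ⟨C', hC', ?_⟩
  filter_upwards [hev, (hh.const_mul_atTop hC').eventually_ge_atTop (T + 1 : ℝ)]
    with ε hε hTε x Q xbar hrun t ht
  have hTt : T + 1 ≤ t := by exact_mod_cast hTε.trans ht
  exact IsEpsOptimal.mono (hT x Q xbar hrun t (by omega)) (hε t (by omega) ht)

lemma hasConvergenceTime_rpow
    (hdec : ErrorDecaysLike f g xs V Q0 (fun t => 1 / (t : ℝ) ^ (3 / 2 : ℝ))) :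
    HasConvergenceTime f g xs V Q0 (fun ε => 1 / ε ^ (2 / 3 : ℝ)) := by
  refine hasConvergenceTime_of_errorDecaysLike ?_ hdec fun C hC =>
    ⟨(C + 1) ^ (2 / 3 : ℝ), by positivity, ?_⟩
  · refine ((tendsto_rpow_atTop (y := 2 / 3) (by norm_num)).comp tendsto_inv_nhdsGT_zero).congr' ?_
    filter_upwards [self_mem_nhdsWithin] with ε hε
    rw [Function.comp_apply, Real.inv_rpow (Set.mem_Ioi.1 hε).le, one_div]
  · filter_upwards [self_mem_nhdsWithin] with ε hε t ht₁ ht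
    rw [Set.mem_Ioi] at hε
    rw [mul_one_div, ← Real.div_rpow (by positivity) hε.le,
      ← Real.le_rpow_inv_iff_of_pos (by positivity) (by positivity) (by norm_num), inv_div,
      div_le_iff₀ hε] at ht
    rw [mul_one_div, div_le_iff₀ (by positivity)]
    linarith

lemma hasConvergenceTime_log {θ : ℝ} (hθ₀ : 0 < θ) (hθ₁ : θ < 1)
    (hdec : ErrorDecaysLike f g xs V Q0 (fun t => 1 / (t : ℝ) * θ ^ ((t : ℝ) / 4))) :
    HasConvergenceTime f g xs V Q0 (fun ε => Real.log (1 / ε)) := by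
  have hlog : Real.log θ < 0 := Real.log_neg hθ₀ hθ₁
  refine hasConvergenceTime_of_errorDecaysLike ?_ hdec fun C hC =>
    ⟨8 / -Real.log θ, div_pos (by norm_num) (neg_pos.2 hlog), ?_⟩
  · simp only [one_div]
    exact Real.tendsto_log_atTop.comp tendsto_inv_nhdsGT_zero
  · filter_upwards [Ioo_mem_nhdsGT (show (0 : ℝ) < 1 / (C + 1) by positivity)] with ε hε t ht₁ ht
    obtain ⟨hε₀, hε₁⟩ := hε
    have hpow : θ ^ ((t : ℝ) / 4) ≤ ε ^ 2 := by
      rw [div_mul_eq_mul_div, div_le_iff₀ (neg_pos.2 hlog), one_div, Real.log_inv] at ht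
      rw [Real.rpow_def_of_pos hθ₀, ← Real.exp_log hε₀, ← Real.exp_nat_mul, Real.exp_le_exp]
      push_cast
      linarith
    have hone : 1 / (t : ℝ) ≤ 1 := (div_le_one (by positivity)).2 (by exact_mod_cast ht₁)
    rw [lt_div_iff₀ (by positivity)] at hε₁
    calc C * (1 / (t : ℝ) * θ ^ ((t : ℝ) / 4)) ≤ C * (1 * ε ^ 2) := by gcongr
      _ = ε * (ε * C) := by ring
      _ ≤ ε * 1 := by gcongr; linarith
      _ = ε := mul_one ε

lemma hasConvergenceTime_of_isLocallyStronglyConcaveAt (hP : StronglyConvexProgram f g α β)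
    (hg : ∀ k, ConvexOn ℝ Set.univ (g k)) (hV : 0 < V) (hVβ : m * β ^ 2 / α ≤ V)
    (hQ0 : Q0 ∈ orthant m) (hxs : IsSolution f g xs) (hls : IsLagrangeMultiplier f g ls)
    (hc : IsLocallyStronglyConcaveAt f g ls D L) :
    HasConvergenceTime f g xs V Q0 (fun ε => Real.log (1 / ε)) := by
  have hpos : 0 < min L (V / 2) := lt_min hc.2.1 (half_pos hV)
  have hlt : min L (V / 2) < V := (min_le_right _ _).trans_lt (half_lt_self hV)
  exact hasConvergenceTime_log (sub_pos.2 ((div_lt_one hV).2 hlt))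
    (sub_lt_self _ (div_pos hpos hV))
    (errorDecaysLike_of_isLocallyStronglyConcaveAt hP hg hV hVβ hQ0 hxs hls
      (hc.mono hpos (min_le_left _ _)))

end Rates

theorem theorem11_general {n m : ℕ} (f : EuclideanSpace ℝ (Fin n) → ℝ)
    (g : Fin m → EuclideanSpace ℝ (Fin n) → ℝ) (xs : EuclideanSpace ℝ (Fin n))
    (hf : ContDiffAt ℝ 2 f xs)
    (hf_sc : ∃ α : ℝ, 0 < α ∧ StrongConvexOn Set.univ α f)
    (hg : ∀ k, ContDiffAt ℝ 2 (g k) xs)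
    (hg_conv : ∀ k, ConvexOn ℝ Set.univ (g k))
    (hg_lip : ∀ k, ∃ β : ℝ, 0 < β ∧ ∀ x y, |g k y - g k x| ≤ β * ‖y - x‖)
    (hxs : IsSolution f g xs) :
    ((activeJacobian g xs).rank = Nat.card {k : Fin m // g k xs = 0} →
      DualWellDefined f g ∧
      (∃ α β, StronglyConvexProgram f g α β) ∧
      StrongDuality f g ∧
      (∃ γ, SmoothDual f g γ) ∧
      LocallyQuadraticDual f g ∧
      ∀ α β V : ℝ, ∀ Q0 ∈ orthant m,
        StronglyConvexProgram f g α β → 0 < V → m * β ^ 2 / α ≤ V →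
          (∃ x Q xbar, IsShiftedRun f g V Q0 x Q xbar) ∧
          ErrorDecaysLike f g xs V Q0 (fun t => 1 / (t : ℝ) ^ (3 / 2 : ℝ)) ∧
          HasConvergenceTime f g xs V Q0 (fun ε => 1 / ε ^ (2 / 3 : ℝ))) ∧
    ((jacobian g xs).rank = m →
      DualWellDefined f g ∧
      (∃ α β, StronglyConvexProgram f g α β) ∧
      StrongDuality f g ∧
      (∃ γ, SmoothDual f g γ) ∧
      LocallyStronglyConcaveDual f g ∧
      ∀ α β V : ℝ, ∀ Q0 ∈ orthant m,
        StronglyConvexProgram f g α β → 0 < V → m * β ^ 2 / α ≤ V →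
          (∃ x Q xbar, IsShiftedRun f g V Q0 x Q xbar) ∧
          (∀ ls D L, IsLagrangeMultiplier f g ls → IsLocallyStronglyConcaveAt f g ls D L →
            ErrorDecaysLike f g xs V Q0
              (fun t => 1 / (t : ℝ) * (1 - L / V) ^ ((t : ℝ) / 4))) ∧
          HasConvergenceTime f g xs V Q0 (fun ε => Real.log (1 / ε))) := by
  obtain ⟨α₀, β₀, hP₀⟩ := exists_stronglyConvexProgram hf_sc hg_lip
  have hD := dualWellDefined hP₀.1 hP₀.2.1 hg_conv
  have hSmooth := exists_smoothDual hP₀ hg_conv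
  have hSD := hxs.strongDuality hP₀.1 hP₀.2.1 hg_conv (hf.differentiableAt two_ne_zero)
    fun k => (hg k).differentiableAt two_ne_zero
  refine ⟨fun hrank => ?_, fun hrank => ?_⟩
  · have hsurj := surjectiveDerivOn_active hrank
    have hquad := locallyQuadraticDual hD hf hg hxs hsurj
    refine ⟨hD, ⟨α₀, β₀, hP₀⟩, hSD hsurj, hSmooth, hquad, fun α β V Q0 hQ0 hP hV hVβ => ?_⟩
    obtain ⟨ls, hls⟩ := hSD hsurj
    obtain ⟨D, L, hq⟩ := hquad ls hls
    have hdec := errorDecaysLike_of_isLocallyQuadraticAt hP hg_conv hV hVβ hQ0 hxs hls hq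
    exact ⟨exists_isShiftedRun hP.1 hP.2.1 hg_conv hV hQ0, hdec, hasConvergenceTime_rpow hdec⟩
  · have hsurj := surjectiveDerivOn_univ hrank
    have hSD := hSD (hsurj.mono (Set.subset_univ _))
    have hconc := locallyStronglyConcaveDual hP₀ hg_conv hf hg hxs hsurj
    refine ⟨hD, ⟨α₀, β₀, hP₀⟩, hSD, hSmooth, hconc, fun α β V Q0 hQ0 hP hV hVβ => ?_⟩
    obtain ⟨ls, hls⟩ := hSD
    obtain ⟨D, L, hc⟩ := hconc ls hls
    exact ⟨exists_isShiftedRun hP.1 hP.2.1 hg_conv hV hQ0, fun ls D L hls hc =>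
      errorDecaysLike_of_isLocallyStronglyConcaveAt hP hg_conv hV hVβ hQ0 hxs hls hc,
      hasConvergenceTime_of_isLocallyStronglyConcaveAt hP hg_conv hV hVβ hQ0 hxs hls hc⟩

end DriftPlusPenalty

open DriftPlusPenalty in
theorem theorem11 {n m : ℕ} (f : EuclideanSpace ℝ (Fin n) → ℝ)
    (g : Fin m → EuclideanSpace ℝ (Fin n) → ℝ) (xs : EuclideanSpace ℝ (Fin n))
    (hf : ContDiff ℝ 2 f)
    (hf_sc : ∃ α : ℝ, 0 < α ∧ StrongConvexOn Set.univ α f)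
    (hg : ∀ k, ContDiff ℝ 2 (g k))
    (hg_conv : ∀ k, ConvexOn ℝ Set.univ (g k))
    (hg_lip : ∀ k, ∃ β : ℝ, 0 < β ∧ ∀ x y, |g k y - g k x| ≤ β * ‖y - x‖)
    (hxs : IsSolution f g xs)
    (hJ : HasBoundedJacobian g) :
    ((activeJacobian g xs).rank = Nat.card {k : Fin m // g k xs = 0} →
      DualWellDefined f g ∧
      (∃ α β, StronglyConvexProgram f g α β) ∧
      StrongDuality f g ∧
      (∃ γ, SmoothDual f g γ) ∧
      LocallyQuadraticDual f g ∧
      ∀ α β γ V : ℝ, ∀ Q0 ∈ orthant m,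
        StronglyConvexProgram f g α β → SmoothDual f g γ →
        0 < V → max (m * β ^ 2 / α) γ ≤ V →
          (∃ x Q xbar, IsShiftedRun f g V Q0 x Q xbar) ∧
          ErrorDecaysLike f g xs V Q0 (fun t => 1 / (t : ℝ) ^ (3 / 2 : ℝ)) ∧
          HasConvergenceTime f g xs V Q0 (fun ε => 1 / ε ^ (2 / 3 : ℝ))) ∧
    ((jacobian g xs).rank = m →
      DualWellDefined f g ∧
      (∃ α β, StronglyConvexProgram f g α β) ∧
      StrongDuality f g ∧
      (∃ γ, SmoothDual f g γ) ∧
      LocallyStronglyConcaveDual f g ∧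
      ∀ α β γ V : ℝ, ∀ Q0 ∈ orthant m,
        StronglyConvexProgram f g α β → SmoothDual f g γ →
        0 < V → max (m * β ^ 2 / α) γ ≤ V →
          (∃ x Q xbar, IsShiftedRun f g V Q0 x Q xbar) ∧
          (∀ ls D L, IsLagrangeMultiplier f g ls → IsLocallyStronglyConcaveAt f g ls D L →
            ErrorDecaysLike f g xs V Q0
              (fun t => 1 / (t : ℝ) * (1 - L / V) ^ ((t : ℝ) / 4))) ∧
          HasConvergenceTime f g xs V Q0 (fun ε => Real.log (1 / ε))) := by
  refine (theorem11_general f g xs hf.contDiffAt hf_sc (fun k => (hg k).contDiffAt) hg_conv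
    hg_lip hxs).imp (fun h hrank => ?_) (fun h hrank => ?_)
  all_goals
    obtain ⟨hD, hP₀, hSD, hSmooth, hcurv, hrates⟩ := h hrank
    exact ⟨hD, hP₀, hSD, hSmooth, hcurv, fun α β _ V Q0 hQ0 hP _ hV hVmax =>
      hrates α β V Q0 hQ0 hP hV (le_of_max_le_left hVmax)⟩
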